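/- Let $\Bbbk$ be a field of characteristic $2$. Let $X=\{1,2\}$, let $X^\omega$ be the set of infinite words over $X$, and let $\mathfrak G$ be the Grigorchuk group, i.e. the group of permutations of $X^\omega$ generated by $a,b,c,d$, where $a$ exchanges the two values of the first letter and $$b(1w)=1\,a(w),\quad b(2w)=2\,c(w),\qquad c(1w)=1\,a(w),\quad c(2w)=2\,d(w),\qquad d(1w)=1w,\quad d(2w)=2\,b(w).$$ Let $\mathcal A$ be its tree enveloping algebra, i.e. the image of the group algebra $\Bbbk\mathfrak G$ in $\operatorname{End}(\Bbbk X^\omega)$, where $\Bbbk X^\omega$ is the vector space with basis $X^\omega$. The augmentation of $\Bbbk\mathfrak G$ induces an algebra homomorphism $\varepsilon:\mathcal A\to\Bbbk$; let $\varpi=\ker\varepsilon$ be the augmentation ideal. Write $A=a-1$, $B=b-1$, $C=c-1$, $D=d-1\in\mathcal A$. A function $f:\mathbb N\to\mathbb N$ has quadratic growth if there are real polynomials $p,q$ of degree $2$ with positive leading coefficients such that $p(n)\le f(n)\le q(n)$ for all $n\in\mathbb N$. The Gelfand-Kirillov dimension of an algebra with an ascending filtration $(\mathcal F_n)_{n\ge0}$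 by finite-dimensional subspaces is $\liminf_{n\to\infty}\log\dim\mathcal F_n/\log n$. 1. For all integers $n\ge3$ and $k\ge0$, $$\dim(\varpi^n/\varpi^{n+1})=\begin{cases}2n-\frac12 2^k&\text{if }2^k\le n\le\frac32 2^k,\\ n+2^k&\text{if }\frac32 2^k\le n\le 2^{k+1}.\end{cases}$$ 2. The algebra $\mathcal A$ has quadratic growth and Gelfand-Kirillov dimension $2$ as a graded algebra (along powers of $\varpi$): if $\mathcal A_n$ denotes the linear span of the words of length $n$ in $A,B,C,D$, then $\mathcal A=\bigoplus_{n\ge0}\mathcal A_n$ is an algebra grading with $\varpi^n=\bigoplus_{m\ge n}\mathcal A_m$ for all $n\ge0$; the function $n\mapsto\dim(\mathcal A_0+\dots+\mathcal A_n)$ has quadratic growth, and the Gelfand-Kirillov dimension of $\mathcal A$ with respect to the filtration $(\mathcal A_0+\dots+\mathcal A_n)_{n\ge0}$ is $2$. 3. The algebra $\mathcal A$ has quadratic growth and Gelfand-Kirillov dimension $2$ as a finitely generated filtered algebra: $\mathcal A$ is finitely generated, and for every finite set $S$ generating $\mathcal A$ as a unital algebra, with $\mathcal F_n$ the linear span of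 all products of at most $n$ elements of $S$ (including the empty product $1$), the function $n\mapsto\dim\mathcal F_n$ has quadratic growth, and the Gelfand-Kirillov dimension of $\mathcal A$ with respect to $(\mathcal F_n)$ is $2$. -/

import Mathlib

open Filter

noncomputable section

/-! ### Growth of sequences of dimensions -/

/-- `f` grows polynomially of degree `d`: it lies between two real polynomials of degree `d` with
positive leading coefficients. Quadratic growth is the case `d = 2`. -/
def HasPolynomialGrowth (d : ℕ) (f : ℕ → ℕ) : Prop :=
  ∃ p q : Polynomial ℝ, p.natDegree = d ∧ q.natDegree = d ∧
    0 < p.leadingCoeff ∧ 0 < q.leadingCoeff ∧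
    ∀ n : ℕ, p.eval (n : ℝ) ≤ (f n : ℝ) ∧ (f n : ℝ) ≤ q.eval (n : ℝ)

/-- The Gelfand-Kirillov dimension `liminf (log (f n) / log n)` attached to the sequence `f n` of
dimensions of the steps of an ascending filtration. -/
def gkDim (f : ℕ → ℕ) : EReal :=
  liminf (fun n : ℕ => ((Real.log (f n) / Real.log n : ℝ) : EReal)) atTop

/-! ### Filtrations of algebras -/

section Filtrations

variable (k : Type*) [Field k]

/-- The linear span of all `n`-fold products of elements of `S`. -/
def productSpan {A : Type*} [Semiring A] [Algebra k A] (S : Set A) (n : ℕ) : Submodule k A :=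
  (Submodule.span k S) ^ n

/-- The ascending filtration `V 0 + ⋯ + V n` attached to a sequence of subspaces. -/
def partialSum {A : Type*} [Semiring A] [Algebra k A] (V : ℕ → Submodule k A) (n : ℕ) : Submodule k A :=
  ⨆ i ≤ n, V i

/-- The dimension over `k` of `I ^ n / I ^ (n + 1)`. -/
def powerQuotientDim (A : Type*) [Ring A] [Algebra k A] (I : Ideal A) (n : ℕ) : ℕ :=
  Module.finrank k (↥(I ^ n) ⧸ (I ^ (n + 1)).submoduleOf (I ^ n))

end Filtrations

/-! ### The tree enveloping algebra of a group acting on rays -/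

section Enveloping

variable (k : Type*) [Field k] {Ω : Type*} (G : Subgroup (Equiv.Perm Ω))

/-- The permutation representation of the group algebra `k G` on the vector space `k Ω` with basis
`Ω` (written `MonoidAlgebra k Ω`, of which only the vector space structure is used). -/
def permAlgHom : MonoidAlgebra k G →ₐ[k] Module.End k (MonoidAlgebra k Ω) :=
  (Representation.ofMulAction k G Ω).asAlgebraHom

/-- The tree enveloping algebra of `G`, acting on the set `Ω` of infinite words: the image of the
group algebra `k G` in `End (k Ω)`. -/
def TreeEnvelopingAlgebra : Subalgebra k (Module.End k (MonoidAlgebra k Ω)) :=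
  (permAlgHom k G).range

/-- The canonical map from the group algebra onto the tree enveloping algebra. -/
def toTreeEnveloping : MonoidAlgebra k G →ₐ[k] TreeEnvelopingAlgebra k G :=
  (permAlgHom k G).rangeRestrict

/-- The augmentation `k G → k`, sending every element of `G` to `1`. -/
def groupAugmentation : MonoidAlgebra k G →ₐ[k] k :=
  MonoidAlgebra.lift k k G 1

/-- The sum of the coefficients of a vector of `k Ω`. -/
def coeffSum : MonoidAlgebra k Ω →ₗ[k] k :=
  Finsupp.linearCombination k (fun _ => (1 : k)) ∘ₗ
    (MonoidAlgebra.coeffLinearEquiv k).toLinearMap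

theorem coeffSum_single (x : Ω) (r : k) :
    coeffSum k (MonoidAlgebra.single x r) = r := by
  simp [coeffSum]

theorem coeffSum_permAlgHom (x : MonoidAlgebra k G) (v : MonoidAlgebra k Ω) :
    coeffSum k (permAlgHom k G x v) = groupAugmentation k G x * coeffSum k v := by
  induction x using MonoidAlgebra.induction_on with
  | of g =>
    have h : coeffSum k ∘ₗ (Representation.ofMulAction k G Ω g) = coeffSum k := by
      ext y
      simp [coeffSum_single]
    have h' := LinearMap.congr_fun h v
    simp only [LinearMap.comp_apply] at h'
    simp [permAlgHom, groupAugmentation, h']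
  | add f h hf hh => simp only [map_add, LinearMap.add_apply, hf, hh, add_mul]
  | smul r f hf =>
    simp only [map_smul, LinearMap.smul_apply, hf, smul_eq_mul, mul_assoc]

variable [Inhabited Ω]

/-- The augmentation of the tree enveloping algebra: the value at `T` is the sum of the entries of
a column of `T` (the choice of the column is irrelevant). -/
def augmentation : TreeEnvelopingAlgebra k G →ₐ[k] k :=
  AlgHom.ofLinearMap
    ({ toFun := fun T => coeffSum k (T.1 (MonoidAlgebra.single default 1))
       map_add' := fun S T => by simp
       map_smul' := fun r T => by simp } : TreeEnvelopingAlgebra k G →ₗ[k] k)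
    (by simp [coeffSum_single])
    (by
      rintro ⟨_, x, rfl⟩ ⟨_, y, rfl⟩
      simp [coeffSum_permAlgHom, coeffSum_single])

/-- The augmentation of the tree enveloping algebra is induced by that of the group algebra. -/
theorem augmentation_comp (x : MonoidAlgebra k G) :
    augmentation k G (toTreeEnveloping k G x) = groupAugmentation k G x := by
  change coeffSum k (permAlgHom k G x (MonoidAlgebra.single default 1)) = _
  rw [coeffSum_permAlgHom, coeffSum_single, mul_one]

/-- The augmentation ideal of the tree enveloping algebra (a two-sided ideal). -/
def augmentationIdeal : Ideal (TreeEnvelopingAlgebra k G) :=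
  RingHom.ker (augmentation k G)

instance : (augmentationIdeal k G).IsTwoSided :=
  inferInstanceAs (RingHom.ker (augmentation k G)).IsTwoSided

end Enveloping

/-! ### The Grigorchuk group -/

namespace Grigorchuk

/-- Infinite words over the two-letter alphabet, with letters `0` and `1`. -/
abbrev Ray : Type := ℕ → Fin 2

/-- Names for the four standard generators. -/
inductive Gen : Type
  | a | b | c | d

/-- The action of the generators on infinite words. The generator `a` changes the first letter;
`b`, `c`, `d` fix the first letter, and act on the rest of the word as
`b = (a, c)`, `c = (a, d)`, `d = (1, b)`: by the first entry after the letter `0`, and by the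
second entry after the letter `1`. -/
def act : Gen → Ray → Ray
  | .a, x, 0 => Equiv.swap 0 1 (x 0)
  | .a, x, n + 1 => x (n + 1)
  | .b, x, 0 => x 0
  | .b, x, n + 1 =>
      if x 0 = 0 then act .a (fun i => x (i + 1)) n else act .c (fun i => x (i + 1)) n
  | .c, x, 0 => x 0
  | .c, x, n + 1 =>
      if x 0 = 0 then act .a (fun i => x (i + 1)) n else act .d (fun i => x (i + 1)) n
  | .d, x, 0 => x 0
  | .d, x, n + 1 =>
      if x 0 = 0 then x (n + 1) else act .b (fun i => x (i + 1)) n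

theorem act_act (s : Gen) (x : Ray) : act s (act s x) = x := by
  funext n
  induction n generalizing s x with
  | zero => cases s <;> simp [act]
  | succ n ih =>
    cases s
    · simp [act]
    all_goals
      by_cases h : x 0 = 0
      · simp [act, h, ih]
      · simp [act, h, ih]

/-- The permutation of the set of infinite words given by a generator. -/
def perm (s : Gen) : Equiv.Perm Ray :=
  Function.Involutive.toPerm (act s) (act_act s)

/-- The Grigorchuk group, acting on infinite words. -/
def group : Subgroup (Equiv.Perm Ray) :=
  Subgroup.closure (Set.range perm)

variable (k : Type*) [Field k]

/-- The tree enveloping algebra of the Grigorchuk group. -/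
abbrev Alg : Type _ := TreeEnvelopingAlgebra k group

/-- The augmentation ideal of the tree enveloping algebra of the Grigorchuk group. -/
abbrev augIdeal : Ideal (Alg k) := augmentationIdeal k group

/-- The elements `A = a - 1`, `B = b - 1`, `C = c - 1`, `D = d - 1` of the tree enveloping
algebra. -/
def shiftedGen (s : Gen) : Alg k :=
  toTreeEnveloping k group
    (MonoidAlgebra.of k group ⟨perm s, Subgroup.subset_closure (Set.mem_range_self s)⟩) - 1

/-- The span of the words of length `n` in `A`, `B`, `C`, `D`. -/
def homogeneous (n : ℕ) : Submodule k (Alg k) :=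
  productSpan k (Set.range (shiftedGen k)) n

end Grigorchuk

end

/-! In characteristic 2 one has `D = B + C`, and the products of any two of `B`, `C` vanish. The
algebra is therefore spanned by 1 and the words in which `A` alternates with `B` or `C`. Splitting
rays by their first letter gives an injective recursion into 2×2 matrices over the algebra: `A`
becomes the all-ones matrix, `B` becomes diag(`A`, `C`) and `C` becomes diag(`A`, `D`).
`GrigorchukModel` isolates these facts; the algebraic argument uses nothing else about the group.

Grading. The recursion roughly halves lengths, and the shape of the matrix shows the ends of the
word. It is constant for words A…A, constant along rows if only the last letter is `A`, and constant
along columns if only the first is. If neither end is `A`, the (i, j) entry is again a combination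
of words beginning with kind i and ending with kind j. Linear operations on entries thus separate
the four types, and induction on length yields a projection onto each space of words
(`exists_isProj`). Hence words of different types or lengths are independent, and length is a
grading.

Dimensions. Let V be the span of `A + C` and `B` (`sums`), s_m = dim V^m, and d_n the dimension in
degree n. The common entry of a word A…A of length 2m+1 ranges over V^m, and the other types reduce
to this one on multiplying by `A` at each end that lacks it. So d_{2m+1} = s_m + s_{m+1} and
d_{2m+2} = 2 s_{m+1}. The relation DAD = 0 makes V^m the whole component of degree m for m ≥ 3
(`sums_pow_eq`), whence d_{2m} = 2 d_m and d_{2m+1} = d_m + d_{m+1} for m ≥ 3. With d_3, d_4, d_5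
this gives the piecewise linear formula (`dim_formula`).

Growth. The bounds n ≤ d_n ≤ 2n + 1 sum to quadratic growth. Filtrations from two finite generating
sets contain one another after a linear change of index, so the result does not depend on the set
(`growth_of_finite`). -/

/-- An augmented algebra generated by three elements `A`, `B`, `C`, together with an injective
matrix recursion of the form satisfied by the generators of the tree enveloping algebra of the
Grigorchuk group. -/
structure GrigorchukModel (k R : Type*) [Field k] [Ring R] [Algebra k R] where
  A : R
  B : R
  C : R
  Φ : R →ₐ[k] Matrix (Fin 2) (Fin 2) R
  ε : R →ₐ[k] k
  Φ_injective : Function.Injective Φ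
  Φ_A : Φ A = !![1, 1; 1, 1]
  Φ_B : Φ B = !![A, 0; 0, C]
  Φ_C : Φ C = !![A, 0; 0, B + C]
  A_mul_A : A * A = 0
  B_mul_B : B * B = 0
  C_mul_C : C * C = 0
  B_mul_C : B * C = 0
  C_mul_B : C * B = 0
  ε_A : ε A = 0
  ε_B : ε B = 0
  ε_C : ε C = 0
  adjoin_eq_top : Algebra.adjoin k {A, B, C} = ⊤

namespace GrigorchukModel

variable {k R : Type*} [Field k] [Ring R] [Algebra k R] (S : GrigorchukModel k R)

/-! ### Spaces of words -/

/-- The span of the letters of each of the two kinds: `A`, and `B`, `C`. -/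
def letters : Fin 2 → Submodule k R :=
  ![Submodule.span k {S.A}, Submodule.span k {S.B, S.C}]

/-- The span of all letters. -/
def gens : Submodule k R := Submodule.span k {S.A, S.B, S.C}

/-- The span of `A + C` and `B`: the sums of the entries of the matrices of `B` and `C`. -/
def sums : Submodule k R := Submodule.span k {S.A + S.C, S.B}

/-- The span of the alternating words of length `n` beginning with a letter of kind `i` and ending
with a letter of kind `j`. -/
def words (i j : Fin 2) : ℕ → Submodule k R
  | 0 => ⊥
  | 1 => if i = j then S.letters i else ⊥
  | n + 2 => S.letters i * words (i + 1) j (n + 1)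

theorem mem_letters_zero {x : R} : x ∈ S.letters 0 ↔ ∃ c : k, c • S.A = x := by
  simp [letters, Submodule.mem_span_singleton]

theorem mem_letters_one {x : R} : x ∈ S.letters 1 ↔ ∃ c d : k, c • S.B + d • S.C = x := by
  simp [letters, Submodule.mem_span_pair]

theorem mem_sums {x : R} : x ∈ S.sums ↔ ∃ c d : k, c • (S.A + S.C) + d • S.B = x := by
  simp [sums, Submodule.mem_span_pair]

theorem A_mem : S.A ∈ S.letters 0 := S.mem_letters_zero.2 ⟨1, by simp⟩
theorem B_mem : S.B ∈ S.letters 1 := S.mem_letters_one.2 ⟨1, 0, by simp⟩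
theorem C_mem : S.C ∈ S.letters 1 := S.mem_letters_one.2 ⟨0, 1, by simp⟩

theorem gens_eq : S.gens = S.letters 0 ⊔ S.letters 1 := by
  simp [gens, letters, Submodule.span_insert]

theorem letters_le (i : Fin 2) : S.letters i ≤ S.gens := by
  rw [gens_eq]
  fin_cases i
  · exact le_sup_left
  · exact le_sup_right

theorem sums_le : S.sums ≤ S.gens := by
  rw [sums, Submodule.span_le, Set.insert_subset_iff, Set.singleton_subset_iff]
  exact ⟨add_mem (S.letters_le 0 S.A_mem) (S.letters_le 1 S.C_mem), S.letters_le 1 S.B_mem⟩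

theorem letters_mul_self (i : Fin 2) : S.letters i * S.letters i = ⊥ := by
  rw [← le_bot_iff, Submodule.mul_le]
  intro x hx y hy
  fin_cases i
  · obtain ⟨c, rfl⟩ := S.mem_letters_zero.1 hx
    obtain ⟨d, rfl⟩ := S.mem_letters_zero.1 hy
    simp [S.A_mul_A]
  · obtain ⟨c, d, rfl⟩ := S.mem_letters_one.1 hx
    obtain ⟨c', d', rfl⟩ := S.mem_letters_one.1 hy
    simp [mul_add, add_mul, S.B_mul_B, S.B_mul_C, S.C_mul_B, S.C_mul_C]

theorem words_zero (i j : Fin 2) : S.words i j 0 = ⊥ := by rw [words]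

theorem words_one (i j : Fin 2) : S.words i j 1 = if i = j then S.letters i else ⊥ := by rw [words]

theorem words_one_self (i : Fin 2) : S.words i i 1 = S.letters i := by simp [words]

theorem words_add_two (i j : Fin 2) (n : ℕ) :
    S.words i j (n + 2) = S.letters i * S.words (i + 1) j (n + 1) := by rw [words]

/-- The definition peels letters from the left; this mirror form serves right multiplication. -/
theorem words_add_two' (i j : Fin 2) (n : ℕ) :
    S.words i j (n + 2) = S.words i (j + 1) (n + 1) * S.letters j := by
  induction n generalizing i with
  | zero =>
    rw [words_add_two]
    simp only [zero_add, words_one]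
    fin_cases i <;> fin_cases j <;> simp
  | succ n ih => rw [words_add_two, ih, words_add_two, mul_assoc]

/-- No alternation needs to be assumed: two adjacent letters of the same kind multiply to zero. -/
theorem letters_mul_words_le (i i' j : Fin 2) (n : ℕ) :
    S.letters i * S.words i' j (n + 1) ≤ S.words i j (n + 2) := by
  obtain rfl | rfl : i' = i + 1 ∨ i' = i := by revert i i'; decide
  · rw [words_add_two]
  · cases n with
    | zero =>
      simp only [zero_add, words_one]
      split_ifs
      · simp [letters_mul_self]
      · simp
    | succ n => rw [words_add_two, ← mul_assoc, letters_mul_self]; simp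

theorem words_mul_letters_le (i j j' : Fin 2) (n : ℕ) :
    S.words i j' (n + 1) * S.letters j ≤ S.words i j (n + 2) := by
  obtain rfl | rfl : j' = j + 1 ∨ j' = j := by revert j j'; decide
  · rw [words_add_two']
  · cases n with
    | zero =>
      simp only [zero_add, words_one]
      split_ifs with h
      · simp [h, letters_mul_self]
      · simp
    | succ n => rw [words_add_two', mul_assoc, letters_mul_self]; simp

theorem words_le (i j : Fin 2) (n : ℕ) : S.words i j n ≤ S.gens ^ n := by
  induction n using Nat.strong_induction_on generalizing i with
  | _ n ih =>
    match n with
    | 0 => simp [words_zero]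
    | 1 =>
      rw [words_one, pow_one]
      split_ifs
      · exact S.letters_le i
      · exact bot_le
    | n + 2 =>
      rw [words_add_two, pow_succ']
      exact mul_le_mul' (S.letters_le i) (ih _ (by omega) _)

theorem gens_pow_mul_letters_le (j : Fin 2) (n : ℕ) :
    S.gens ^ n * S.letters j ≤ S.words 0 j (n + 1) ⊔ S.words 1 j (n + 1) := by
  induction n with
  | zero =>
    rw [pow_zero, one_mul, zero_add]
    fin_cases j <;> simp [words_one]
  | succ n ih =>
    rw [pow_succ', mul_assoc]
    refine (mul_le_mul' le_rfl ih).trans ?_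
    rw [gens_eq, Submodule.sup_mul, Submodule.mul_sup, Submodule.mul_sup]
    refine sup_le (sup_le ?_ ?_) (sup_le ?_ ?_)
    · exact (S.letters_mul_words_le 0 0 j n).trans le_sup_left
    · exact (S.letters_mul_words_le 0 1 j n).trans le_sup_left
    · exact (S.letters_mul_words_le 1 0 j n).trans le_sup_right
    · exact (S.letters_mul_words_le 1 1 j n).trans le_sup_right

theorem letters_mul_gens_pow_mul_letters_le (i j : Fin 2) (n : ℕ) :
    S.letters i * (S.gens ^ n * S.letters j) ≤ S.words i j (n + 2) := by
  refine (mul_le_mul' le_rfl (S.gens_pow_mul_letters_le j n)).trans ?_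
  rw [Submodule.mul_sup]
  exact sup_le (S.letters_mul_words_le i 0 j n) (S.letters_mul_words_le i 1 j n)

theorem letters_mul_gens_pow_le (i : Fin 2) (n : ℕ) :
    S.letters i * S.gens ^ n ≤ S.words i 0 (n + 1) ⊔ S.words i 1 (n + 1) := by
  cases n with
  | zero =>
    rw [pow_zero, mul_one, zero_add]
    fin_cases i <;> simp [words_one]
  | succ n =>
    rw [pow_succ]
    nth_rw 2 [gens_eq]
    rw [Submodule.mul_sup, Submodule.mul_sup]
    exact sup_le_sup (S.letters_mul_gens_pow_mul_letters_le i 0 n)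
      (S.letters_mul_gens_pow_mul_letters_le i 1 n)

theorem gens_pow_succ_eq (n : ℕ) :
    S.gens ^ (n + 1) =
      (S.words 0 0 (n + 1) ⊔ S.words 0 1 (n + 1)) ⊔
        (S.words 1 0 (n + 1) ⊔ S.words 1 1 (n + 1)) := by
  apply le_antisymm
  · rw [pow_succ']
    nth_rw 1 [gens_eq]
    rw [Submodule.sup_mul]
    exact sup_le_sup (S.letters_mul_gens_pow_le 0 n) (S.letters_mul_gens_pow_le 1 n)
  · simp only [sup_le_iff]
    exact ⟨⟨S.words_le _ _ _, S.words_le _ _ _⟩, S.words_le _ _ _, S.words_le _ _ _⟩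

/-- Kinds alternate, so the parity of the length decides whether the two ends have the same kind. -/
theorem words_even_eq_bot (j : Fin 2) (m : ℕ) :
    S.words j j (2 * m) = ⊥ ∧ S.words (j + 1) j (2 * m + 1) = ⊥ := by
  induction m with
  | zero => exact ⟨S.words_zero _ _, by simp [words_one]⟩
  | succ m ih =>
    have h : S.words j j (2 * (m + 1)) = ⊥ := by
      rw [show 2 * (m + 1) = 2 * m + 2 by ring, words_add_two, ih.2, Submodule.mul_bot]
    refine ⟨h, ?_⟩
    rw [show 2 * (m + 1) + 1 = 2 * m + 1 + 2 by ring, words_add_two]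
    have hj : j + 1 + 1 = j := by clear ih h; revert j; decide
    rw [hj, show 2 * m + 1 + 1 = 2 * (m + 1) by ring, h, Submodule.mul_bot]

/-! ### Matrices of words -/

/-- The sum of the entries of the matrix of an element. -/
def entrySum : R →ₗ[k] R where
  toFun x := S.Φ x 0 0 + S.Φ x 0 1 + (S.Φ x 1 0 + S.Φ x 1 1)
  map_add' x y := by simp only [map_add, Matrix.add_apply]; abel
  map_smul' c x := by simp [smul_add]

theorem entrySum_apply (x : R) :
    S.entrySum x = S.Φ x 0 0 + S.Φ x 0 1 + (S.Φ x 1 0 + S.Φ x 1 1) := rfl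

theorem Φ_ext {x y : R} (h : ∀ i j, S.Φ x i j = S.Φ y i j) : x = y :=
  S.Φ_injective (Matrix.ext h)

theorem Φ_A_apply (i j : Fin 2) : S.Φ S.A i j = 1 := by
  rw [Φ_A]; fin_cases i <;> fin_cases j <;> rfl

theorem Φ_A_mul (x : R) (i j : Fin 2) : S.Φ (S.A * x) i j = S.Φ x 0 j + S.Φ x 1 j := by
  rw [map_mul, Matrix.mul_apply]
  simp [Φ_A_apply, Fin.sum_univ_two]

theorem Φ_mul_A (x : R) (i j : Fin 2) : S.Φ (x * S.A) i j = S.Φ x i 0 + S.Φ x i 1 := by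
  rw [map_mul, Matrix.mul_apply]
  simp [Φ_A_apply, Fin.sum_univ_two]

theorem Φ_A_mul_mul_A (x : R) (i j : Fin 2) : S.Φ (S.A * (x * S.A)) i j = S.entrySum x := by
  rw [Φ_A_mul, Φ_mul_A, Φ_mul_A]; rfl

/-- The diagonal entry of index i has kind i; this match between matrix indices and kinds of letters
drives every later induction. The sum of the two entries is what survives between two copies of `A`.
-/
theorem Φ_of_mem_letters_one {x : R} (hx : x ∈ S.letters 1) :
    ∃ f : Fin 2 → R, (∀ i, f i ∈ S.letters i) ∧ f 0 + f 1 ∈ S.sums ∧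
      S.Φ x = Matrix.diagonal f := by
  obtain ⟨c, d, rfl⟩ := S.mem_letters_one.1 hx
  refine ⟨![(c + d) • S.A, c • S.C + d • (S.B + S.C)], fun i => ?_, ?_, ?_⟩
  · fin_cases i
    · exact Submodule.smul_mem _ _ S.A_mem
    · exact add_mem (Submodule.smul_mem _ _ S.C_mem)
        (Submodule.smul_mem _ _ (add_mem S.B_mem S.C_mem))
  · refine S.mem_sums.2 ⟨c + d, d, ?_⟩
    simp only [Matrix.cons_val_zero, Matrix.cons_val_one]
    module
  · simp only [map_add, map_smul, Φ_B, Φ_C]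
    ext i j
    fin_cases i <;> fin_cases j <;> simp [add_smul]

theorem exists_entrySum_eq {v : R} (hv : v ∈ S.sums) :
    ∃ x ∈ S.letters 1, ∃ f : Fin 2 → R, S.Φ x = Matrix.diagonal f ∧ f 0 + f 1 = v := by
  obtain ⟨c, d, rfl⟩ := S.mem_sums.1 hv
  -- The coefficients c', d' of `B`, `C` solve c' + d' = c and d' = d, since c'`B` + d'`C` has entry
  -- sum (c' + d')(`A` + `C`) + d'`B`.
  refine ⟨(c - d) • S.B + d • S.C, S.mem_letters_one.2 ⟨_, _, rfl⟩,
    ![c • S.A, (c - d) • S.C + d • (S.B + S.C)], ?_, ?_⟩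
  · simp only [map_add, map_smul, Φ_B, Φ_C]
    ext i j
    fin_cases i <;> fin_cases j <;> simp [sub_smul]
  · simp only [Matrix.cons_val_zero, Matrix.cons_val_one]
    module

/-- With J the all-ones matrix, J diag(f) J = (f 0 + f 1) J. Each inner letter thus contributes one
factor from `sums`. -/
theorem Φ_words_zero_zero {m : ℕ} {x : R} (hx : x ∈ S.words 0 0 (2 * m + 1)) :
    ∃ w ∈ S.sums ^ m, ∀ i j, S.Φ x i j = w := by
  induction m generalizing x with
  | zero =>
    rw [mul_zero, zero_add, words_one_self] at hx
    obtain ⟨c, rfl⟩ := S.mem_letters_zero.1 hx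
    refine ⟨algebraMap k R c, by simp [Submodule.mem_one], fun i j => ?_⟩
    rw [map_smul, Matrix.smul_apply, Φ_A_apply, Algebra.algebraMap_eq_smul_one]
  | succ m ih =>
    rw [show 2 * (m + 1) + 1 = 2 * m + 1 + 2 by ring, words_add_two, words_add_two] at hx
    change x ∈ S.letters 0 * (S.letters 1 * S.words 0 0 (2 * m + 1)) at hx
    induction hx using Submodule.mul_induction_on' with
    | mem_mul_mem a ha y hy =>
      obtain ⟨c, rfl⟩ := S.mem_letters_zero.1 ha
      induction hy using Submodule.mul_induction_on' with
      | mem_mul_mem l hl t ht =>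
        obtain ⟨f, -, hf, hΦ⟩ := S.Φ_of_mem_letters_one hl
        obtain ⟨w, hw, hΦw⟩ := ih ht
        refine ⟨c • ((f 0 + f 1) * w), Submodule.smul_mem _ _ ?_, fun i j => ?_⟩
        · rw [pow_succ']; exact Submodule.mul_mem_mul hf hw
        · rw [smul_mul_assoc, map_smul, Matrix.smul_apply, Φ_A_mul, map_mul, hΦ,
            Matrix.diagonal_mul, Matrix.diagonal_mul, hΦw, hΦw, add_mul]
      | add y _ z _ hy hz =>
        obtain ⟨u, hu, hu'⟩ := hy
        obtain ⟨v, hv, hv'⟩ := hz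
        exact ⟨u + v, add_mem hu hv, fun i j => by
          rw [mul_add, map_add, Matrix.add_apply, hu', hv']⟩
    | add y _ z _ hy hz =>
      obtain ⟨u, hu, hu'⟩ := hy
      obtain ⟨v, hv, hv'⟩ := hz
      exact ⟨u + v, add_mem hu hv, fun i j => by rw [map_add, Matrix.add_apply, hu', hv']⟩

theorem exists_words_zero_zero {m : ℕ} {w : R} (hw : w ∈ S.sums ^ m) :
    ∃ x ∈ S.words 0 0 (2 * m + 1), ∀ i j, S.Φ x i j = w := by
  induction m generalizing w with
  | zero =>
    rw [pow_zero, Submodule.mem_one] at hw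
    obtain ⟨c, rfl⟩ := hw
    rw [mul_zero, zero_add, words_one_self]
    refine ⟨c • S.A, Submodule.smul_mem _ _ S.A_mem, fun i j => ?_⟩
    rw [map_smul, Matrix.smul_apply, Φ_A_apply, Algebra.algebraMap_eq_smul_one]
  | succ m ih =>
    rw [show 2 * (m + 1) + 1 = 2 * m + 1 + 2 by ring, words_add_two, words_add_two]
    rw [pow_succ'] at hw
    induction hw using Submodule.mul_induction_on' with
    | mem_mul_mem v hv u hu =>
      obtain ⟨l, hl, f, hΦ, rfl⟩ := S.exists_entrySum_eq hv
      obtain ⟨t, ht, hΦt⟩ := ih hu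
      refine ⟨S.A * (l * t), Submodule.mul_mem_mul S.A_mem (Submodule.mul_mem_mul hl ht),
        fun i j => ?_⟩
      rw [Φ_A_mul, map_mul, hΦ, Matrix.diagonal_mul, Matrix.diagonal_mul, hΦt, hΦt, add_mul]
    | add y _ z _ hy hz =>
      obtain ⟨u, hu, hu'⟩ := hy
      obtain ⟨v, hv, hv'⟩ := hz
      exact ⟨u + v, add_mem hu hv, fun i j => by rw [map_add, Matrix.add_apply, hu', hv']⟩

theorem Φ_words_one_zero {m : ℕ} {x : R} (hx : x ∈ S.words 1 0 (2 * m + 2)) :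
    ∃ p : Fin 2 → R, (∀ i, p i ∈ S.letters i * S.gens ^ m) ∧ ∀ i j, S.Φ x i j = p i := by
  rw [words_add_two] at hx
  induction hx using Submodule.mul_induction_on' with
  | mem_mul_mem l hl t ht =>
    obtain ⟨f, hf, -, hΦ⟩ := S.Φ_of_mem_letters_one hl
    obtain ⟨w, hw, hΦw⟩ := S.Φ_words_zero_zero ht
    refine ⟨fun i => f i * w, fun i => Submodule.mul_mem_mul (hf i)
      (pow_le_pow_left' S.sums_le m hw), fun i j => ?_⟩
    rw [map_mul, hΦ, Matrix.diagonal_mul, hΦw]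
  | add y _ z _ hy hz =>
    obtain ⟨u, hu, hu'⟩ := hy
    obtain ⟨v, hv, hv'⟩ := hz
    exact ⟨u + v, fun i => add_mem (hu i) (hv i), fun i j => by
      rw [map_add, Matrix.add_apply, hu', hv']; rfl⟩

theorem Φ_words_zero_one {m : ℕ} {x : R} (hx : x ∈ S.words 0 1 (2 * m + 2)) :
    ∃ p : Fin 2 → R, (∀ j, p j ∈ S.gens ^ m * S.letters j) ∧ ∀ i j, S.Φ x i j = p j := by
  rw [words_add_two'] at hx
  induction hx using Submodule.mul_induction_on' with
  | mem_mul_mem t ht l hl =>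
    obtain ⟨f, hf, -, hΦ⟩ := S.Φ_of_mem_letters_one hl
    obtain ⟨w, hw, hΦw⟩ := S.Φ_words_zero_zero ht
    refine ⟨fun i => w * f i, fun i => Submodule.mul_mem_mul
      (pow_le_pow_left' S.sums_le m hw) (hf i), fun i j => ?_⟩
    rw [map_mul, hΦ, Matrix.mul_diagonal, hΦw]
  | add y _ z _ hy hz =>
    obtain ⟨u, hu, hu'⟩ := hy
    obtain ⟨v, hv, hv'⟩ := hz
    exact ⟨u + v, fun i => add_mem (hu i) (hv i), fun i j => by
      rw [map_add, Matrix.add_apply, hu', hv']; rfl⟩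

/-- Beyond length 1, such a word is a diagonal matrix times a matrix constant along columns. The (i,
j) entry is f i * p j, whose outer letters have kinds i and j. -/
theorem Φ_words_one_one {m : ℕ} {x : R} (hx : x ∈ S.words 1 1 (2 * m + 1)) (i j : Fin 2) :
    S.Φ x i j ∈ S.words i j (m + 1) := by
  cases m with
  | zero =>
    rw [mul_zero, zero_add, words_one_self] at hx
    obtain ⟨f, hf, -, hΦ⟩ := S.Φ_of_mem_letters_one hx
    rw [hΦ, zero_add, words_one]
    split_ifs with h
    · subst h; rw [Matrix.diagonal_apply_eq]; exact hf i
    · rw [Matrix.diagonal_apply_ne _ h]; exact zero_mem _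
  | succ m =>
    rw [show 2 * (m + 1) + 1 = 2 * m + 1 + 2 by ring, words_add_two] at hx
    induction hx using Submodule.mul_induction_on' with
    | mem_mul_mem l hl t ht =>
      obtain ⟨f, hf, -, hΦ⟩ := S.Φ_of_mem_letters_one hl
      obtain ⟨p, hp, hΦt⟩ := S.Φ_words_zero_one ht
      rw [map_mul, hΦ, Matrix.diagonal_mul, hΦt]
      exact S.letters_mul_gens_pow_mul_letters_le i j m (Submodule.mul_mem_mul (hf i) (hp j))
    | add y _ z _ hy hz => rw [map_add]; exact add_mem hy hz

theorem ε_of_mem_gens_pow {n : ℕ} {x : R} (hx : x ∈ S.gens ^ (n + 1)) : S.ε x = 0 := by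
  rw [pow_succ'] at hx
  induction hx using Submodule.mul_induction_on' with
  | mem_mul_mem l hl t ht =>
    have : S.gens ≤ LinearMap.ker S.ε.toLinearMap := by
      rw [gens, Submodule.span_le]
      rintro y (rfl | rfl | rfl)
      · exact S.ε_A
      · exact S.ε_B
      · exact S.ε_C
    have h : S.ε l = 0 := this hl
    rw [map_mul, h, zero_mul]
  | add y _ z _ hy hz => rw [map_add, hy, hz, add_zero]

end GrigorchukModel

namespace GrigorchukModel

variable {k R : Type*} [Field k] [Ring R] [Algebra k R] (S : GrigorchukModel k R)

/-! ### Projections onto the spaces of words -/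

/-- The linear map `π` restricts to the identity on the words of length `n` beginning with a
letter of kind `i` and ending with a letter of kind `j`, and kills all other words. -/
structure IsProj (i j : Fin 2) (n : ℕ) (π : R →ₗ[k] R) : Prop where
  one : π 1 = 0
  apply : ∀ i' j' n', ∀ x ∈ S.words i' j' n', π x = if i' = i ∧ j' = j ∧ n' = n then x else 0

/-- By parity every other index triple gives the zero space, so four families remain to be checked.
-/
theorem words_cases {P : Fin 2 → Fin 2 → ℕ → R → Prop} (h : ∀ i j n, P i j n 0)
    (h₀₀ : ∀ m, ∀ x ∈ S.words 0 0 (2 * m + 1), P 0 0 (2 * m + 1) x)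
    (h₀₁ : ∀ m, ∀ x ∈ S.words 0 1 (2 * m + 2), P 0 1 (2 * m + 2) x)
    (h₁₀ : ∀ m, ∀ x ∈ S.words 1 0 (2 * m + 2), P 1 0 (2 * m + 2) x)
    (h₁₁ : ∀ m, ∀ x ∈ S.words 1 1 (2 * m + 1), P 1 1 (2 * m + 1) x)
    (i j : Fin 2) (n : ℕ) (x : R) (hx : x ∈ S.words i j n) : P i j n x := by
  have hz : S.words i j n = ⊥ → P i j n x := fun hb => by
    rw [hb, Submodule.mem_bot] at hx
    rw [hx]
    exact h i j n
  obtain ⟨m, rfl | rfl⟩ := Nat.even_or_odd' n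
  · cases m with
    | zero => exact hz (S.words_zero _ _)
    | succ m =>
      fin_cases i <;> fin_cases j
      · exact hz (S.words_even_eq_bot 0 _).1
      · exact h₀₁ m x hx
      · exact h₁₀ m x hx
      · exact hz (S.words_even_eq_bot 1 _).1
  · fin_cases i <;> fin_cases j
    · exact h₀₀ m x hx
    · exact hz (S.words_even_eq_bot 1 _).2
    · exact hz (S.words_even_eq_bot 0 _).2
    · exact h₁₁ m x hx

/-- The entries of the matrix of an element. -/
def entry (i j : Fin 2) : R →ₗ[k] R where
  toFun x := S.Φ x i j
  map_add' x y := by rw [map_add, Matrix.add_apply]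
  map_smul' c x := by simp

theorem entry_apply (i j : Fin 2) (x : R) : S.entry i j x = S.Φ x i j := rfl

/-- A linear left inverse of `Φ` turns a recipe for matrix entries into an endomorphism. It is
controlled only where the recipe yields a matrix in the range of `Φ`, which is enough on words. -/
theorem exists_linearMap_of_entries (f : Fin 2 → Fin 2 → R →ₗ[k] R) :
    ∃ π : R →ₗ[k] R, ∀ x y, (∀ i j, S.Φ y i j = f i j x) → π x = y := by
  obtain ⟨Ψ, hΨ⟩ := S.Φ.toLinearMap.exists_leftInverse_of_injective
    (LinearMap.ker_eq_bot.2 S.Φ_injective)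
  refine ⟨⟨⟨fun x => Ψ (Matrix.of fun i j => f i j x), fun x y => ?_⟩, fun c x => ?_⟩,
    fun x y h => ?_⟩
  · have : Matrix.of (fun i j => f i j (x + y)) =
        Matrix.of (fun i j => f i j x) + Matrix.of (fun i j => f i j y) := by ext i j; simp
    rw [this, map_add]
  · have : Matrix.of (fun i j => f i j (c • x)) = c • Matrix.of (fun i j => f i j x) := by
      ext i j; simp
    change Ψ (Matrix.of fun i j => f i j (c • x)) = c • Ψ (Matrix.of fun i j => f i j x)
    rw [this, map_smul]
  · have : Matrix.of (fun i j => f i j x) = S.Φ y := by ext i j; simp [h]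
    change Ψ (Matrix.of fun i j => f i j x) = y
    rw [this]
    exact LinearMap.congr_fun hΨ y

section Sums

variable {S} {n : ℕ} {π : Fin 2 → Fin 2 → R →ₗ[k] R} (hπ : ∀ i j, S.IsProj i j n (π i j))
include hπ

/-- The four projections of length n add up to the projection onto degree n. Degree 0 is excluded
because each of them kills constants. -/
theorem sum_proj_of_mem_gens_pow (hn : n ≠ 0) {m : ℕ} {w : R} (hw : w ∈ S.gens ^ m) :
    π 0 0 w + π 0 1 w + (π 1 0 w + π 1 1 w) = if m = n then w else 0 := by
  cases m with
  | zero =>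
    rw [pow_zero, Submodule.mem_one] at hw
    obtain ⟨c, rfl⟩ := hw
    simp [Algebra.algebraMap_eq_smul_one, (hπ _ _).one, hn.symm]
  | succ m =>
    rw [gens_pow_succ_eq] at hw
    obtain ⟨u, hu, v, hv, rfl⟩ := Submodule.mem_sup.1 hw
    obtain ⟨a, ha, b, hb, rfl⟩ := Submodule.mem_sup.1 hu
    obtain ⟨c, hc, d, hd, rfl⟩ := Submodule.mem_sup.1 hv
    simp only [map_add, (hπ _ _).apply _ _ _ _ ha, (hπ _ _).apply _ _ _ _ hb,
      (hπ _ _).apply _ _ _ _ hc, (hπ _ _).apply _ _ _ _ hd]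
    by_cases h : m + 1 = n <;> simp [h]

theorem sum_proj_of_mem_letters_mul {m : ℕ} {i : Fin 2} {p : R}
    (hp : p ∈ S.letters i * S.gens ^ m) (i' : Fin 2) :
    π i' 0 p + π i' 1 p = if i = i' ∧ m + 1 = n then p else 0 := by
  obtain ⟨a, ha, b, hb, rfl⟩ := Submodule.mem_sup.1 (S.letters_mul_gens_pow_le _ _ hp)
  simp only [map_add, (hπ _ _).apply _ _ _ _ ha, (hπ _ _).apply _ _ _ _ hb]
  by_cases h : i = i' ∧ m + 1 = n <;> simp [h]

theorem sum_proj_of_mem_mul_letters {m : ℕ} {j : Fin 2} {p : R}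
    (hp : p ∈ S.gens ^ m * S.letters j) (j' : Fin 2) :
    π 0 j' p + π 1 j' p = if j = j' ∧ m + 1 = n then p else 0 := by
  obtain ⟨a, ha, b, hb, rfl⟩ := Submodule.mem_sup.1 (S.gens_pow_mul_letters_le _ _ hp)
  simp only [map_add, (hπ _ _).apply _ _ _ _ ha, (hπ _ _).apply _ _ _ _ hb]
  by_cases h : j = j' ∧ m + 1 = n <;> simp [h]

end Sums

theorem A_ne_zero : S.A ≠ 0 := fun h => by
  have h1 : (1 : R) = 0 := by rw [← S.Φ_A_apply 0 0, h, map_zero]; rfl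
  have := congrArg S.ε h1
  simp at this

/-- The coefficient of `A` in the expansion of an element as a sum of words. -/
def coeffA : R →ₗ[k] k := S.ε.toLinearMap ∘ₗ S.entry 0 1

theorem coeffA_apply (x : R) : S.coeffA x = S.ε (S.Φ x 0 1) := rfl

/-- Apart from the word `A`, whose entries are 1, the off-diagonal entry of a word lies in a
positive power of `gens` and is killed by `ε`. -/
theorem coeffA_smul_A (i j : Fin 2) (n : ℕ) (x : R) (hx : x ∈ S.words i j n) :
    S.coeffA x • S.A = if i = 0 ∧ j = 0 ∧ n = 1 then x else 0 := by
  simp only [coeffA_apply]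
  revert i j n x
  refine S.words_cases (by simp) ?_ ?_ ?_ ?_
  · intro m x hx
    obtain ⟨w, hw, hΦ⟩ := S.Φ_words_zero_zero hx
    rw [hΦ]
    cases m with
    | zero =>
      rw [mul_zero, zero_add, words_one_self] at hx
      obtain ⟨c, rfl⟩ := S.mem_letters_zero.1 hx
      have := hΦ 0 1
      rw [map_smul, Matrix.smul_apply, Φ_A_apply] at this
      simp [← this]
    | succ m => simp [S.ε_of_mem_gens_pow (pow_le_pow_left' S.sums_le _ hw)]
  · intro m x hx
    obtain ⟨p, hp, hΦ⟩ := S.Φ_words_zero_one hx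
    have h := hp 1
    rw [hΦ, S.ε_of_mem_gens_pow (n := m) ?_]
    · simp
    · rw [pow_succ]; exact mul_le_mul' le_rfl (S.letters_le 1) h
  · intro m x hx
    obtain ⟨p, hp, hΦ⟩ := S.Φ_words_one_zero hx
    have h := hp 0
    rw [hΦ, S.ε_of_mem_gens_pow (n := m) ?_]
    · simp
    · rw [pow_succ']; exact mul_le_mul' (S.letters_le 0) le_rfl h
  · intro m x hx
    rw [S.ε_of_mem_gens_pow (n := m) (S.words_le _ _ _ (S.Φ_words_one_one hx 0 1))]
    simp

theorem exists_isProj_zero_zero_one : ∃ π, S.IsProj 0 0 1 π :=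
  ⟨LinearMap.toSpanSingleton k R S.A ∘ₗ S.coeffA, by simp [coeffA_apply], fun i j n x hx => by
    simpa using S.coeffA_smul_A i j n x hx⟩

theorem coeffA_of_mem_words {i j : Fin 2} {n : ℕ} {x : R} (hx : x ∈ S.words i j n)
    (h : ¬(i = 0 ∧ j = 0 ∧ n = 1)) : S.coeffA x = 0 := by
  have := S.coeffA_smul_A i j n x hx
  rw [if_neg h] at this
  exact (smul_eq_zero.1 this).resolve_right S.A_ne_zero

theorem coeffA_of_mem_gens_pow {n : ℕ} {x : R} (hx : x ∈ S.gens ^ (n + 2)) : S.coeffA x = 0 := by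
  rw [gens_pow_succ_eq] at hx
  obtain ⟨u, hu, v, hv, rfl⟩ := Submodule.mem_sup.1 hx
  obtain ⟨a, ha, b, hb, rfl⟩ := Submodule.mem_sup.1 hu
  obtain ⟨c, hc, d, hd, rfl⟩ := Submodule.mem_sup.1 hv
  simp only [map_add, S.coeffA_of_mem_words ha (by omega), S.coeffA_of_mem_words hb (by omega),
    S.coeffA_of_mem_words hc (by omega), S.coeffA_of_mem_words hd (by omega), add_zero]

/-- Each entry is fed to the projection with the opposite pair of ends. On a constant matrix the
four terms add up to the degree n part of the common entry. Words of the other three types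
contribute only entries whose first or last letter has the wrong kind. -/
theorem exists_isProj_zero_zero {n : ℕ} {π : Fin 2 → Fin 2 → R →ₗ[k] R}
    (hπ : ∀ i j, S.IsProj i j n (π i j)) (hn : n ≠ 0) : ∃ ρ, S.IsProj 0 0 (2 * n + 1) ρ := by
  obtain ⟨ρ, hρ⟩ := S.exists_linearMap_of_entries fun _ _ =>
    π 1 1 ∘ₗ S.entry 0 0 + π 0 0 ∘ₗ S.entry 1 1 + (π 1 0 ∘ₗ S.entry 0 1 + π 0 1 ∘ₗ S.entry 1 0)
  simp only [LinearMap.add_apply, LinearMap.comp_apply, entry_apply] at hρ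
  refine ⟨ρ, hρ _ _ ?_, S.words_cases (by simp) ?_ ?_ ?_ ?_⟩
  · simp [(hπ _ _).one]
  · intro m x hx
    obtain ⟨w, hw, hΦ⟩ := S.Φ_words_zero_zero hx
    refine hρ _ _ fun i j => ?_
    have h := sum_proj_of_mem_gens_pow hπ hn (pow_le_pow_left' S.sums_le m hw)
    simp only [hΦ]
    rw [show π 1 1 w + π 0 0 w + (π 1 0 w + π 0 1 w) = π 0 0 w + π 0 1 w + (π 1 0 w + π 1 1 w) by
      abel, h]
    by_cases hm : m = n <;> simp [hm, hΦ]
  · intro m x hx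
    obtain ⟨p, hp, hΦ⟩ := S.Φ_words_zero_one hx
    refine hρ _ _ fun i j => ?_
    have h₀ := sum_proj_of_mem_mul_letters hπ (hp 0) 1
    have h₁ := sum_proj_of_mem_mul_letters hπ (hp 1) 0
    simp only [hΦ]
    rw [show π 1 1 (p 0) + π 0 0 (p 1) + (π 1 0 (p 1) + π 0 1 (p 0)) =
      (π 0 1 (p 0) + π 1 1 (p 0)) + (π 0 0 (p 1) + π 1 0 (p 1)) by abel, h₀, h₁]
    simp
  · intro m x hx
    obtain ⟨p, hp, hΦ⟩ := S.Φ_words_one_zero hx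
    refine hρ _ _ fun i j => ?_
    have h₀ := sum_proj_of_mem_letters_mul hπ (hp 0) 1
    have h₁ := sum_proj_of_mem_letters_mul hπ (hp 1) 0
    simp only [hΦ]
    rw [show π 1 1 (p 0) + π 0 0 (p 1) + (π 1 0 (p 0) + π 0 1 (p 1)) =
      (π 1 0 (p 0) + π 1 1 (p 0)) + (π 0 0 (p 1) + π 0 1 (p 1)) by abel, h₀, h₁]
    simp
  · intro m x hx
    refine hρ _ _ fun i j => ?_
    simp [(hπ _ _).apply _ _ _ _ (S.Φ_words_one_one hx _ _)]

/-- Subtracting rows removes the matrices that are constant or constant along columns. Pairing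
column 1 with words ending in kind 0, and column 0 with kind 1, removes the words with neither end
`A`. What is left of a matrix constant along rows is the part of p i of length n + 1 beginning with
kind i. -/
theorem exists_isProj_one_zero {n : ℕ} {π : Fin 2 → Fin 2 → R →ₗ[k] R}
    (hπ : ∀ i j, S.IsProj i j (n + 1) (π i j)) : ∃ ρ, S.IsProj 1 0 (2 * n + 2) ρ := by
  obtain ⟨ρ, hρ⟩ := S.exists_linearMap_of_entries fun i _ =>
    π i 0 ∘ₗ (S.entry i 1 - S.entry (i + 1) 1) + π i 1 ∘ₗ (S.entry i 0 - S.entry (i + 1) 0)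
  simp only [LinearMap.add_apply, LinearMap.comp_apply, LinearMap.sub_apply, entry_apply] at hρ
  have hne : ∀ i : Fin 2, i + 1 ≠ i := by decide
  refine ⟨ρ, hρ _ _ ?_, S.words_cases (by simp) ?_ ?_ ?_ ?_⟩
  · intro i j
    fin_cases i <;> simp [(hπ _ _).one]
  · intro m x hx
    obtain ⟨w, hw, hΦ⟩ := S.Φ_words_zero_zero hx
    refine hρ _ _ fun i j => ?_
    simp [hΦ]
  · intro m x hx
    obtain ⟨p, hp, hΦ⟩ := S.Φ_words_zero_one hx
    refine hρ _ _ fun i j => ?_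
    simp [hΦ]
  · intro m x hx
    obtain ⟨p, hp, hΦ⟩ := S.Φ_words_one_zero hx
    refine hρ _ _ fun i j => ?_
    have h₀ := sum_proj_of_mem_letters_mul hπ (hp i) i
    have h₁ := sum_proj_of_mem_letters_mul hπ (hp (i + 1)) i
    simp only [hΦ, map_sub]
    rw [show π i 0 (p i) - π i 0 (p (i + 1)) + (π i 1 (p i) - π i 1 (p (i + 1))) =
      (π i 0 (p i) + π i 1 (p i)) - (π i 0 (p (i + 1)) + π i 1 (p (i + 1))) by abel, h₀, h₁]
    by_cases hm : m = n <;> simp [hm, hΦ, hne]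
  · intro m x hx
    refine hρ _ _ fun i j => ?_
    simp [(hπ _ _).apply _ _ _ _ (S.Φ_words_one_one hx _ _), hne]

/-- The transposed recipe, with columns subtracted in place of rows. -/
theorem exists_isProj_zero_one {n : ℕ} {π : Fin 2 → Fin 2 → R →ₗ[k] R}
    (hπ : ∀ i j, S.IsProj i j (n + 1) (π i j)) : ∃ ρ, S.IsProj 0 1 (2 * n + 2) ρ := by
  obtain ⟨ρ, hρ⟩ := S.exists_linearMap_of_entries fun _ j =>
    π 0 j ∘ₗ (S.entry 1 j - S.entry 1 (j + 1)) + π 1 j ∘ₗ (S.entry 0 j - S.entry 0 (j + 1))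
  simp only [LinearMap.add_apply, LinearMap.comp_apply, LinearMap.sub_apply, entry_apply] at hρ
  have hne : ∀ i : Fin 2, i + 1 ≠ i := by decide
  refine ⟨ρ, hρ _ _ ?_, S.words_cases (by simp) ?_ ?_ ?_ ?_⟩
  · intro i j
    fin_cases j <;> simp [(hπ _ _).one]
  · intro m x hx
    obtain ⟨w, hw, hΦ⟩ := S.Φ_words_zero_zero hx
    refine hρ _ _ fun i j => ?_
    simp [hΦ]
  · intro m x hx
    obtain ⟨p, hp, hΦ⟩ := S.Φ_words_zero_one hx
    refine hρ _ _ fun i j => ?_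
    have h₀ := sum_proj_of_mem_mul_letters hπ (hp j) j
    have h₁ := sum_proj_of_mem_mul_letters hπ (hp (j + 1)) j
    simp only [hΦ, map_sub]
    rw [show π 0 j (p j) - π 0 j (p (j + 1)) + (π 1 j (p j) - π 1 j (p (j + 1))) =
      (π 0 j (p j) + π 1 j (p j)) - (π 0 j (p (j + 1)) + π 1 j (p (j + 1))) by abel, h₀, h₁]
    by_cases hm : m = n <;> simp [hm, hΦ, hne]
  · intro m x hx
    obtain ⟨p, hp, hΦ⟩ := S.Φ_words_one_zero hx
    refine hρ _ _ fun i j => ?_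
    simp [hΦ]
  · intro m x hx
    refine hρ _ _ fun i j => ?_
    simp [(hπ _ _).apply _ _ _ _ (S.Φ_words_one_one hx _ _), hne]

theorem entrySum_mem {m : ℕ} {x : R} (hx : x ∈ S.words 1 1 (2 * m + 1)) :
    S.entrySum x ∈ S.gens ^ (m + 1) := by
  rw [gens_pow_succ_eq]
  exact add_mem
    (Submodule.mem_sup_left (add_mem (Submodule.mem_sup_left (S.Φ_words_one_one hx 0 0))
      (Submodule.mem_sup_right (S.Φ_words_one_one hx 0 1))))
    (Submodule.mem_sup_right (add_mem (Submodule.mem_sup_left (S.Φ_words_one_one hx 1 0))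
      (Submodule.mem_sup_right (S.Φ_words_one_one hx 1 1))))

theorem entrySum_smul_B_add_smul_C (c d : k) :
    S.entrySum (c • S.B + d • S.C) = (c + d) • (S.A + S.C) + d • S.B := by
  simp only [map_add, map_smul, entrySum_apply, Φ_B, Φ_C]
  simp only [Matrix.of_apply, Matrix.cons_val', Matrix.cons_val_zero, Matrix.cons_val_one,
    Matrix.cons_val_fin_one]
  module

variable [CharP k 2]

theorem add_self (_ : GrigorchukModel k R) (x : R) : x + x = 0 := by
  rw [← two_smul k x, CharTwo.two_eq_zero, zero_smul]

theorem entrySum_one : S.entrySum 1 = 0 := by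
  simp [entrySum_apply, S.add_self]

theorem entrySum_of_mem_words_zero_zero {m : ℕ} {x : R} (hx : x ∈ S.words 0 0 (2 * m + 1)) :
    S.entrySum x = 0 := by
  obtain ⟨w, hw, hΦ⟩ := S.Φ_words_zero_zero hx
  rw [entrySum_apply, hΦ, hΦ, hΦ, hΦ, S.add_self]

theorem entrySum_of_mem_words_zero_one {m : ℕ} {x : R} (hx : x ∈ S.words 0 1 (2 * m + 2)) :
    S.entrySum x = 0 := by
  obtain ⟨p, hp, hΦ⟩ := S.Φ_words_zero_one hx
  rw [entrySum_apply, hΦ, hΦ, hΦ, hΦ, S.add_self]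

theorem entrySum_of_mem_words_one_zero {m : ℕ} {x : R} (hx : x ∈ S.words 1 0 (2 * m + 2)) :
    S.entrySum x = 0 := by
  obtain ⟨p, hp, hΦ⟩ := S.Φ_words_one_zero hx
  rw [entrySum_apply, hΦ, hΦ, hΦ, hΦ, S.add_self, S.add_self, add_zero]

/-- In characteristic 2 the entry sum kills the three other types, whose entries repeat an even
number of times. On the remaining type it adds four entries of different types, and the projection
of type (i, j) recovers the (i, j) entry. -/
theorem exists_isProj_one_one {n : ℕ} {π : Fin 2 → Fin 2 → R →ₗ[k] R}
    (hπ : ∀ i j, S.IsProj i j (n + 1) (π i j)) : ∃ ρ, S.IsProj 1 1 (2 * n + 1) ρ := by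
  obtain ⟨ρ, hρ⟩ := S.exists_linearMap_of_entries fun i j => π i j ∘ₗ S.entrySum
  simp only [LinearMap.comp_apply] at hρ
  refine ⟨ρ, hρ _ _ ?_, S.words_cases (by simp) ?_ ?_ ?_ ?_⟩
  · simp [entrySum_one]
  · intro m x hx
    refine hρ _ _ fun i j => ?_
    simp [S.entrySum_of_mem_words_zero_zero hx]
  · intro m x hx
    refine hρ _ _ fun i j => ?_
    simp [S.entrySum_of_mem_words_zero_one hx]
  · intro m x hx
    refine hρ _ _ fun i j => ?_
    simp [S.entrySum_of_mem_words_one_zero hx]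
  · intro m x hx
    refine hρ _ _ fun i j => ?_
    have h := fun i' j' => (hπ i j).apply _ _ _ _ (S.Φ_words_one_one hx i' j')
    rw [entrySum_apply]
    simp only [map_add, h]
    by_cases hm : m = n
    · subst hm
      fin_cases i <;> fin_cases j <;> simp
    · simp [hm]

theorem entrySum_of_mem_words {i j : Fin 2} {n : ℕ} {x : R} (hx : x ∈ S.words i j n)
    (h : ¬(i = 1 ∧ j = 1)) : S.entrySum x = 0 := by
  exact S.words_cases (P := fun i j _ x => ¬(i = 1 ∧ j = 1) → S.entrySum x = 0)
    (fun _ _ _ _ => map_zero _)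
    (fun _ _ hx _ => S.entrySum_of_mem_words_zero_zero hx)
    (fun _ _ hx _ => S.entrySum_of_mem_words_zero_one hx)
    (fun _ _ hx _ => S.entrySum_of_mem_words_one_zero hx)
    (fun _ _ _ h => (h ⟨rfl, rfl⟩).elim) i j n x hx h

theorem coeffA_entrySum_of_mem_gens_pow {n : ℕ} {x : R} (hx : x ∈ S.gens ^ (n + 2)) :
    S.coeffA (S.entrySum x) = 0 := by
  rw [gens_pow_succ_eq] at hx
  obtain ⟨u, hu, v, hv, rfl⟩ := Submodule.mem_sup.1 hx
  obtain ⟨a, ha, b, hb, rfl⟩ := Submodule.mem_sup.1 hu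
  obtain ⟨c, hc, d, hd, rfl⟩ := Submodule.mem_sup.1 hv
  simp only [map_add, S.entrySum_of_mem_words ha (by decide), S.entrySum_of_mem_words hb (by decide),
    S.entrySum_of_mem_words hc (by decide), zero_add]
  obtain ⟨m, hm | hm⟩ := Nat.even_or_odd' (n + 2)
  · change d ∈ S.words 1 1 (n + 2) at hd
    rw [hm, (S.words_even_eq_bot 1 m).1, Submodule.mem_bot] at hd
    simp [hd]
  · change d ∈ S.words 1 1 (n + 2) at hd
    obtain ⟨l, rfl⟩ : ∃ l, m = l + 1 := ⟨m - 1, by omega⟩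
    rw [hm] at hd
    exact S.coeffA_of_mem_gens_pow (S.entrySum_mem hd)

theorem exists_isProj_one_one_one : ∃ ρ, S.IsProj 1 1 1 ρ := by
  -- For x = c`B` + d`C`, the coefficient of `A` is c + d in `entrySum` x, and c + 2d = c after
  -- applying `entrySum` twice. These two functionals determine c and d.
  refine ⟨LinearMap.toSpanSingleton k R S.B ∘ₗ S.coeffA ∘ₗ S.entrySum ∘ₗ S.entrySum +
    LinearMap.toSpanSingleton k R S.C ∘ₗ (S.coeffA ∘ₗ S.entrySum -
      S.coeffA ∘ₗ S.entrySum ∘ₗ S.entrySum), by simp [entrySum_one], fun i j n x hx => ?_⟩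
  simp only [LinearMap.add_apply, LinearMap.comp_apply, LinearMap.sub_apply,
    LinearMap.toSpanSingleton_apply]
  by_cases hij : i = 1 ∧ j = 1
  · obtain ⟨rfl, rfl⟩ := hij
    obtain ⟨m, rfl | rfl⟩ := Nat.even_or_odd' n
    · rw [(S.words_even_eq_bot 1 m).1, Submodule.mem_bot] at hx
      simp [hx]
    · cases m with
      | zero =>
        rw [mul_zero, zero_add, words_one_self] at hx
        obtain ⟨c, d, rfl⟩ := S.mem_letters_one.1 hx
        have hB := S.coeffA_of_mem_words (i := 1) (j := 1) (n := 1) (x := S.B)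
          (by rw [words_one_self]; exact S.B_mem) (by decide)
        have hC := S.coeffA_of_mem_words (i := 1) (j := 1) (n := 1) (x := S.C)
          (by rw [words_one_self]; exact S.C_mem) (by decide)
        have hA : S.coeffA S.A = 1 := by simp [coeffA_apply, Φ_A_apply]
        have hSA : S.entrySum S.A = 0 := S.entrySum_of_mem_words (i := 0) (j := 0) (n := 1)
          (by rw [words_one_self]; exact S.A_mem) (by decide)
        have hSB : S.entrySum S.B = S.A + S.C := by
          simpa using S.entrySum_smul_B_add_smul_C 1 0
        have hSC : S.entrySum S.C = S.A + S.C + S.B := by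
          simpa using S.entrySum_smul_B_add_smul_C 0 1
        have h2 : d + d = 0 := CharTwo.add_self_eq_zero d
        rw [S.entrySum_smul_B_add_smul_C]
        simp only [map_add, map_smul, hA, hB, hC, hSA, hSB, hSC, smul_eq_mul, mul_one, mul_zero,
          add_zero, zero_add, add_assoc, h2]
        simp
      | succ m =>
        have h := S.entrySum_mem hx
        simp [S.coeffA_of_mem_gens_pow h, S.coeffA_entrySum_of_mem_gens_pow h]
  · rw [S.entrySum_of_mem_words hx hij, if_neg (by tauto)]
    simp

/-- Length 1 has to be handled apart: for `A` the common entry is a constant, which projections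
kill, and for `B`, `C` the recursion does not shorten the word. -/
theorem exists_isProj (i j : Fin 2) (n : ℕ) : ∃ π, S.IsProj i j n π := by
  induction n using Nat.strong_induction_on generalizing i j with
  | _ n ih =>
    have hb : S.words i j n = ⊥ → ∃ π, S.IsProj i j n π := fun hb => by
      refine ⟨0, rfl, fun i' j' n' x hx => ?_⟩
      split_ifs with h
      · obtain ⟨rfl, rfl, rfl⟩ := h
        rw [hb, Submodule.mem_bot] at hx
        simp [hx]
      · rfl
    obtain ⟨m, rfl | rfl⟩ := Nat.even_or_odd' n
    · cases m with
      | zero => exact hb (S.words_zero _ _)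
      | succ m =>
        choose π hπ using fun i j => ih (m + 1) (by omega) i j
        fin_cases i <;> fin_cases j
        · exact hb (S.words_even_eq_bot 0 _).1
        · exact S.exists_isProj_zero_one hπ
        · exact S.exists_isProj_one_zero hπ
        · exact hb (S.words_even_eq_bot 1 _).1
    · fin_cases i <;> fin_cases j
      · cases m with
        | zero => exact S.exists_isProj_zero_zero_one
        | succ m =>
          choose π hπ using fun i j => ih (m + 1) (by omega) i j
          exact S.exists_isProj_zero_zero hπ (by omega)
      · exact hb (S.words_even_eq_bot 1 _).2
      · exact hb (S.words_even_eq_bot 0 _).2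
      · cases m with
        | zero => exact S.exists_isProj_one_one_one
        | succ m =>
          choose π hπ using fun i j => ih (m + 1 + 1) (by omega) i j
          exact S.exists_isProj_one_one hπ

end GrigorchukModel

/-! ### Auxiliary linear algebra -/

theorem Submodule.iSup_pow_mul_le {k A : Type*} [CommSemiring k] [Semiring A] [Algebra k A]
    (N : Submodule k A) : (⨆ n, N ^ n) * (⨆ n, N ^ n) ≤ ⨆ n, N ^ n := by
  rw [Submodule.iSup_mul]
  refine iSup_le fun m => ?_
  rw [Submodule.mul_iSup]
  refine iSup_le fun n => ?_
  rw [← pow_add]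
  exact le_iSup (fun n => N ^ n) _

theorem Algebra.toSubmodule_adjoin_le_iSup_span_pow {k A : Type*} [CommSemiring k] [Semiring A]
    [Algebra k A] (s : Set A) :
    Subalgebra.toSubmodule (Algebra.adjoin k s) ≤ ⨆ n, Submodule.span k s ^ n := by
  intro x hx
  rw [Subalgebra.mem_toSubmodule] at hx
  induction hx using Algebra.adjoin_induction with
  | mem x hx =>
    exact Submodule.mem_iSup_of_mem 1 (by rw [pow_one]; exact Submodule.subset_span hx)
  | algebraMap r =>
    exact Submodule.mem_iSup_of_mem 0 (by rw [pow_zero]; exact Submodule.algebraMap_mem r)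
  | add x y _ _ hx hy => exact add_mem hx hy
  | mul x y _ _ hx hy => exact Submodule.iSup_pow_mul_le _ (Submodule.mul_mem_mul hx hy)

theorem LinearMap.finrank_eq_of_map_eq {k V W : Type*} [Field k] [AddCommGroup V] [Module k V]
    [AddCommGroup W] [Module k W] (f : V →ₗ[k] W) {p : Submodule k V} {q : Submodule k W}
    (hf : ∀ x ∈ p, f x = 0 → x = 0) (hpq : ∀ x ∈ p, f x ∈ q) (hqp : ∀ y ∈ q, ∃ x ∈ p, f x = y) :
    Module.finrank k p = Module.finrank k q := by
  have h : LinearMap.range (f.domRestrict p) = q := by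
    rw [LinearMap.range_domRestrict]
    ext y
    exact ⟨fun ⟨x, hx, h⟩ => h ▸ hpq x hx, fun hy => hqp y hy⟩
  rw [← h, LinearMap.finrank_range_of_inj]
  rw [← LinearMap.ker_eq_bot, LinearMap.ker_eq_bot']
  rintro ⟨x, hx⟩ h0
  exact Subtype.ext (hf x hx h0)

theorem Submodule.finrank_sup_of_disjoint {k V : Type*} [Field k] [AddCommGroup V] [Module k V]
    {s t : Submodule k V} [FiniteDimensional k s] [FiniteDimensional k t] (h : Disjoint s t) :
    Module.finrank k ↑(s ⊔ t) = Module.finrank k s + Module.finrank k t := by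
  rw [← Submodule.finrank_sup_add_finrank_inf_eq, h.eq_bot, finrank_bot, add_zero]

/-! ### Independence of words and of degrees -/

namespace GrigorchukModel

variable {k R : Type*} [Field k] [Ring R] [Algebra k R] (S : GrigorchukModel k R)

theorem finite_gens : Module.Finite k S.gens :=
  Module.Finite.span_of_finite k (by simp)

instance finite_gens_pow (n : ℕ) : Module.Finite k ↑(S.gens ^ n) :=
  Module.Finite.iff_fg.2 (Submodule.FG.pow (Module.Finite.iff_fg.1 S.finite_gens) n)

instance finite_words (i j : Fin 2) (n : ℕ) : Module.Finite k (S.words i j n) :=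
  Submodule.finiteDimensional_of_le (S.words_le i j n)

theorem iSup_gens_pow : ⨆ n, S.gens ^ n = ⊤ := by
  rw [← top_le_iff, ← Algebra.top_toSubmodule, ← S.adjoin_eq_top]
  exact Algebra.toSubmodule_adjoin_le_iSup_span_pow _

variable [CharP k 2]

theorem exists_degreeProj (n : ℕ) :
    ∃ Q : R →ₗ[k] R, ∀ m, ∀ x ∈ S.gens ^ m, Q x = if m = n then x else 0 := by
  cases n with
  | zero =>
    refine ⟨LinearMap.toSpanSingleton k R 1 ∘ₗ S.ε.toLinearMap, fun m x hx => ?_⟩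
    cases m with
    | zero =>
      rw [pow_zero, Submodule.mem_one] at hx
      obtain ⟨c, rfl⟩ := hx
      simp [Algebra.algebraMap_eq_smul_one]
    | succ m => simp [S.ε_of_mem_gens_pow hx]
  | succ n =>
    choose π hπ using fun i j => S.exists_isProj i j (n + 1)
    exact ⟨π 0 0 + π 0 1 + (π 1 0 + π 1 1), fun m x hx =>
      sum_proj_of_mem_gens_pow hπ n.succ_ne_zero hx⟩

theorem disjoint_gens_pow_of_le {n : ℕ} {N : Submodule k R}
    (hN : N ≤ ⨆ m, ⨆ (_ : m ≠ n), S.gens ^ m) : Disjoint (S.gens ^ n) N := by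
  obtain ⟨Q, hQ⟩ := S.exists_degreeProj n
  rw [Submodule.disjoint_def]
  intro x hx hx'
  have hker : ⨆ m, ⨆ (_ : m ≠ n), S.gens ^ m ≤ LinearMap.ker Q := by
    refine iSup₂_le fun m hm y hy => ?_
    rw [LinearMap.mem_ker, hQ m y hy, if_neg hm]
  have h0 : Q x = 0 := hker (hN hx')
  rwa [hQ n x hx, if_pos rfl] at h0

theorem iSupIndep_gens_pow : iSupIndep fun n => S.gens ^ n :=
  fun _ => S.disjoint_gens_pow_of_le le_rfl

theorem disjoint_words {i j i' j' : Fin 2} {n n' : ℕ} (h : ¬(i' = i ∧ j' = j ∧ n' = n)) :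
    Disjoint (S.words i j n) (S.words i' j' n') := by
  obtain ⟨π, hπ⟩ := S.exists_isProj i j n
  rw [Submodule.disjoint_def]
  intro x hx hx'
  have h1 := hπ.apply _ _ _ x hx
  rw [if_pos ⟨rfl, rfl, rfl⟩] at h1
  rw [← h1, hπ.apply _ _ _ x hx', if_neg h]

theorem finrank_gens_pow_odd (m : ℕ) :
    Module.finrank k ↑(S.gens ^ (2 * m + 1)) =
      Module.finrank k (S.words 0 0 (2 * m + 1)) + Module.finrank k (S.words 1 1 (2 * m + 1)) := by
  rw [gens_pow_succ_eq, show S.words 0 1 (2 * m + 1) = ⊥ from (S.words_even_eq_bot 1 m).2,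
    show S.words 1 0 (2 * m + 1) = ⊥ from (S.words_even_eq_bot 0 m).2, sup_bot_eq, bot_sup_eq]
  exact Submodule.finrank_sup_of_disjoint (S.disjoint_words (by simp))

theorem finrank_gens_pow_even (m : ℕ) :
    Module.finrank k ↑(S.gens ^ (2 * m + 2)) =
      Module.finrank k (S.words 0 1 (2 * m + 2)) + Module.finrank k (S.words 1 0 (2 * m + 2)) := by
  rw [gens_pow_succ_eq, show S.words 0 0 (2 * m + 2) = ⊥ from (S.words_even_eq_bot 0 (m + 1)).1,
    show S.words 1 1 (2 * m + 2) = ⊥ from (S.words_even_eq_bot 1 (m + 1)).1, sup_bot_eq,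
    bot_sup_eq]
  exact Submodule.finrank_sup_of_disjoint (S.disjoint_words (by simp))

/-! ### Dimensions of the spaces of words -/

omit [CharP k 2] in
theorem finrank_words_zero_zero (m : ℕ) :
    Module.finrank k (S.words 0 0 (2 * m + 1)) = Module.finrank k ↑(S.sums ^ m) := by
  refine (S.entry 0 0).finrank_eq_of_map_eq (fun x hx h => ?_) (fun x hx => ?_) fun w hw => ?_
  · obtain ⟨w, -, hw⟩ := S.Φ_words_zero_zero hx
    rw [entry_apply, hw] at h
    refine S.Φ_ext fun i j => ?_
    rw [hw, h, map_zero]; rfl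
  · obtain ⟨w, hw, hΦ⟩ := S.Φ_words_zero_zero hx
    rwa [entry_apply, hΦ]
  · obtain ⟨x, hx, hΦ⟩ := S.exists_words_zero_zero hw
    exact ⟨x, hx, hΦ 0 0⟩

/-- The entries of `A` * x are p 0 + p 1, and the two summands begin with letters of different
kinds, so neither can cancel the other. -/
theorem eq_zero_of_A_mul_eq_zero {m : ℕ} {x : R} (hx : x ∈ S.words 1 0 (2 * m + 2))
    (h : S.A * x = 0) : x = 0 := by
  obtain ⟨p, hp, hΦ⟩ := S.Φ_words_one_zero hx
  have h0 := S.Φ_A_mul x 0 0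
  rw [h, map_zero, hΦ, hΦ, Matrix.zero_apply] at h0
  choose π hπ using fun i j => S.exists_isProj i j (m + 1)
  have hp0 : ∀ i, p i = 0 := fun i => by
    have h₀ := sum_proj_of_mem_letters_mul hπ (hp 0) i
    have h₁ := sum_proj_of_mem_letters_mul hπ (hp 1) i
    have hs : (π i 0 (p 0) + π i 1 (p 0)) + (π i 0 (p 1) + π i 1 (p 1)) =
      π i 0 (p 0 + p 1) + π i 1 (p 0 + p 1) := by simp only [map_add]; abel
    rw [← h0, h₀, h₁] at hs
    fin_cases i <;> simpa using hs
  refine S.Φ_ext fun i j => ?_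
  rw [hΦ, hp0, map_zero]; rfl

theorem eq_zero_of_mul_A_eq_zero {m : ℕ} {x : R} (hx : x ∈ S.words 0 1 (2 * m + 2))
    (h : x * S.A = 0) : x = 0 := by
  obtain ⟨p, hp, hΦ⟩ := S.Φ_words_zero_one hx
  have h0 := S.Φ_mul_A x 0 0
  rw [h, map_zero, hΦ, hΦ, Matrix.zero_apply] at h0
  choose π hπ using fun i j => S.exists_isProj i j (m + 1)
  have hp0 : ∀ i, p i = 0 := fun i => by
    have h₀ := sum_proj_of_mem_mul_letters hπ (hp 0) i
    have h₁ := sum_proj_of_mem_mul_letters hπ (hp 1) i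
    have hs : (π 0 i (p 0) + π 1 i (p 0)) + (π 0 i (p 1) + π 1 i (p 1)) =
      π 0 i (p 0 + p 1) + π 1 i (p 0 + p 1) := by simp only [map_add]; abel
    rw [← h0, h₀, h₁] at hs
    fin_cases i <;> simpa using hs
  refine S.Φ_ext fun i j => ?_
  rw [hΦ, hp0, map_zero]; rfl

/-- The four entries lie in spaces of words of four different types, hence are independent. -/
theorem eq_zero_of_entrySum_eq_zero {m : ℕ} {x : R} (hx : x ∈ S.words 1 1 (2 * m + 1))
    (h : S.entrySum x = 0) : x = 0 := by
  have hΦ := S.Φ_words_one_one hx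
  refine S.Φ_ext fun i j => ?_
  obtain ⟨π, hπ⟩ := S.exists_isProj i j (m + 1)
  have h0 := congrArg π h
  simp only [entrySum_apply, map_add, map_zero, hπ.apply _ _ _ _ (hΦ _ _)] at h0
  rw [map_zero]
  fin_cases i <;> fin_cases j <;> simpa using h0

theorem finrank_words_one_zero (m : ℕ) :
    Module.finrank k (S.words 1 0 (2 * m + 2)) = Module.finrank k ↑(S.sums ^ (m + 1)) := by
  rw [← finrank_words_zero_zero]
  refine (LinearMap.mulLeft k S.A).finrank_eq_of_map_eq (fun x hx h => ?_) (fun x hx => ?_)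
    fun w hw => ?_
  · exact S.eq_zero_of_A_mul_eq_zero hx h
  · exact S.letters_mul_words_le 0 1 0 _ (Submodule.mul_mem_mul S.A_mem hx)
  · exact Submodule.mem_span_singleton_mul.1 hw

theorem finrank_words_zero_one (m : ℕ) :
    Module.finrank k (S.words 0 1 (2 * m + 2)) = Module.finrank k ↑(S.sums ^ (m + 1)) := by
  rw [← finrank_words_zero_zero]
  refine (LinearMap.mulRight k S.A).finrank_eq_of_map_eq (fun x hx h => ?_) (fun x hx => ?_)
    fun w hw => ?_
  · exact S.eq_zero_of_mul_A_eq_zero hx h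
  · exact S.words_mul_letters_le 0 0 1 _ (Submodule.mul_mem_mul hx S.A_mem)
  · rw [show 2 * (m + 1) + 1 = 2 * m + 1 + 2 by ring, words_add_two'] at hw
    exact Submodule.mem_mul_span_singleton.1 hw

/-- The isomorphism is x ↦ `A` x `A`; it is injective because every entry of the image is the entry
sum of x. -/
theorem finrank_words_one_one (m : ℕ) :
    Module.finrank k (S.words 1 1 (2 * m + 1)) = Module.finrank k ↑(S.sums ^ (m + 1)) := by
  rw [← finrank_words_zero_zero]
  refine (LinearMap.mulLeft k S.A ∘ₗ LinearMap.mulRight k S.A).finrank_eq_of_map_eq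
    (fun x hx h => ?_) (fun x hx => ?_) fun w hw => ?_
  · refine S.eq_zero_of_entrySum_eq_zero hx ?_
    change S.A * (x * S.A) = 0 at h
    rw [← S.Φ_A_mul_mul_A x 0 0, h, map_zero]; rfl
  · exact S.letters_mul_words_le 0 1 0 _ (Submodule.mul_mem_mul S.A_mem
      (S.words_mul_letters_le 1 0 1 _ (Submodule.mul_mem_mul hx S.A_mem)))
  · rw [show 2 * (m + 1) + 1 = 2 * m + 1 + 2 by ring, words_add_two, words_add_two'] at hw
    obtain ⟨y, hy, rfl⟩ := Submodule.mem_span_singleton_mul.1 hw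
    obtain ⟨x, hx, rfl⟩ := Submodule.mem_mul_span_singleton.1 hy
    exact ⟨x, hx, rfl⟩

/-- The dimension of the space of sums of words of length `m` in `A + C` and `B`. -/
noncomputable def sumDim (m : ℕ) : ℕ := Module.finrank k ↑(S.sums ^ m)

theorem finrank_gens_pow_odd' (m : ℕ) :
    Module.finrank k ↑(S.gens ^ (2 * m + 1)) = S.sumDim m + S.sumDim (m + 1) := by
  rw [finrank_gens_pow_odd, finrank_words_zero_zero, finrank_words_one_one]; rfl

theorem finrank_gens_pow_even' (m : ℕ) :
    Module.finrank k ↑(S.gens ^ (2 * m + 2)) = 2 * S.sumDim (m + 1) := by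
  rw [finrank_gens_pow_even, finrank_words_zero_one, finrank_words_one_zero, two_mul]; rfl

/-! ### Initial values of the dimensions -/

omit [CharP k 2] in
theorem linearIndependent_B_C {c d : k} (h : c • S.B + d • S.C = 0) : c = 0 ∧ d = 0 := by
  -- The upper diagonal entry (c + d)`A` gives c + d = 0. The lower one is d`B` + (c + d)`C`, so the
  -- same argument applies to it and gives d + (c + d) = 0.
  have key : ∀ c d : k, c • S.B + d • S.C = 0 → c + d = 0 := fun c d h => by
    have h0 := congrArg (fun x => S.Φ x 0 0) h
    simp only [map_add, map_smul, Φ_B, Φ_C, map_zero] at h0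
    simp only [Matrix.add_apply, Matrix.smul_apply, Matrix.of_apply, Matrix.cons_val',
      Matrix.cons_val_zero, Matrix.cons_val_fin_one, ← add_smul, Matrix.zero_apply] at h0
    exact (smul_eq_zero.1 h0).resolve_right S.A_ne_zero
  have h1 := congrArg (fun x => S.Φ x 1 1) h
  simp only [map_add, map_smul, Φ_B, Φ_C, map_zero] at h1
  simp only [Matrix.add_apply, Matrix.smul_apply, Matrix.of_apply, Matrix.cons_val',
    Matrix.cons_val_one, Matrix.cons_val_fin_one, Matrix.zero_apply] at h1
  have h2 : d • S.B + (c + d) • S.C = 0 := by rw [← h1]; module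
  have h3 := key _ _ h
  have h4 := key _ _ h2
  rw [h3, add_zero] at h4
  exact ⟨by rwa [h4, add_zero] at h3, h4⟩

omit [CharP k 2] in
theorem sumDim_zero : S.sumDim 0 = 1 := by
  have : Nontrivial R := ⟨S.A, 0, S.A_ne_zero⟩
  rw [sumDim, pow_zero, Submodule.one_eq_span]
  exact finrank_span_singleton one_ne_zero

theorem sumDim_one : S.sumDim 1 = 2 := by
  have h := S.finrank_words_one_one 0
  rw [sumDim, ← zero_add 1, ← h, mul_zero, zero_add, words_one_self]
  have hli : LinearIndependent k ![S.B, S.C] :=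
    LinearIndependent.pair_iff.2 fun c d h => S.linearIndependent_B_C h
  have := finrank_span_eq_card hli
  rw [Matrix.range_cons, Matrix.range_cons, Matrix.range_empty, Set.union_empty,
    Set.singleton_union] at this
  exact this

theorem eq_zero_of_A_mul_mul_A_eq_zero {x : R} (hx : x ∈ S.letters 1)
    (h : S.A * (x * S.A) = 0) : x = 0 := by
  rw [← words_one_self] at hx
  refine S.eq_zero_of_entrySum_eq_zero (m := 0) hx ?_
  rw [← S.Φ_A_mul_mul_A x 0 0, h, map_zero]; rfl

/-- As `B` * `B` = 0, three products remain. A relation among them splits into a part `A` * x and a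
part y * `A` with x, y combinations of `B` and `C`; these are of different types, so both vanish. -/
theorem sumDim_two : S.sumDim 2 = 3 := by
  have hli : LinearIndependent k
      ![(S.A + S.C) * (S.A + S.C), (S.A + S.C) * S.B, S.B * (S.A + S.C)] := by
    rw [Fintype.linearIndependent_iff]
    intro g hg
    simp only [Fin.sum_univ_three, Matrix.cons_val, add_mul, mul_add, S.A_mul_A, S.C_mul_B,
      S.C_mul_C, S.B_mul_C, zero_add, add_zero] at hg
    have hxl : g 1 • S.B + g 0 • S.C ∈ S.letters 1 := S.mem_letters_one.2 ⟨_, _, rfl⟩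
    have hyl : g 2 • S.B + g 0 • S.C ∈ S.letters 1 := S.mem_letters_one.2 ⟨_, _, rfl⟩
    have hx : S.A * (g 1 • S.B + g 0 • S.C) ∈ S.words 0 1 2 :=
      S.letters_mul_words_le 0 1 1 0
        (Submodule.mul_mem_mul S.A_mem (by rw [zero_add, words_one_self]; exact hxl))
    have hy : (g 2 • S.B + g 0 • S.C) * S.A ∈ S.words 1 0 2 :=
      S.words_mul_letters_le 1 0 1 0
        (Submodule.mul_mem_mul (by rw [zero_add, words_one_self]; exact hyl) S.A_mem)
    have hs : S.A * (g 1 • S.B + g 0 • S.C) + (g 2 • S.B + g 0 • S.C) * S.A = 0 := by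
      rw [← hg]
      simp only [mul_add, add_mul, mul_smul_comm, smul_mul_assoc, smul_add]
      abel
    have hx0 : S.A * (g 1 • S.B + g 0 • S.C) = 0 := by
      refine Submodule.disjoint_def.1 (S.disjoint_words (i' := 1) (j' := 0) (n' := 2) (by simp)) _ hx ?_
      rw [eq_neg_of_add_eq_zero_left hs]
      exact neg_mem hy
    rw [hx0, zero_add] at hs
    obtain ⟨h1, h0⟩ := S.linearIndependent_B_C (S.eq_zero_of_A_mul_mul_A_eq_zero hxl
      (by rw [← mul_assoc, hx0, zero_mul]))
    obtain ⟨h2, -⟩ := S.linearIndependent_B_C (S.eq_zero_of_A_mul_mul_A_eq_zero hyl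
      (by rw [hs, mul_zero]))
    intro i
    fin_cases i
    exacts [h0, h1, h2]
  have hspan : S.sums ^ 2 = Submodule.span k (Set.range
      ![(S.A + S.C) * (S.A + S.C), (S.A + S.C) * S.B, S.B * (S.A + S.C)]) := by
    rw [pow_two, sums, Submodule.span_mul_span]
    apply le_antisymm <;> rw [Submodule.span_le]
    · rintro _ ⟨x, rfl | rfl, y, rfl | rfl, rfl⟩
      · exact Submodule.subset_span ⟨0, rfl⟩
      · exact Submodule.subset_span ⟨1, rfl⟩
      · exact Submodule.subset_span ⟨2, rfl⟩
      · simp [S.B_mul_B]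
    · rintro _ ⟨i, rfl⟩
      apply Submodule.subset_span
      fin_cases i
      · exact Set.mul_mem_mul (by simp) (by simp)
      · exact Set.mul_mem_mul (by simp) (by simp)
      · exact Set.mul_mem_mul (by simp) (by simp)
  rw [sumDim, hspan, finrank_span_eq_card hli, Fintype.card_fin]

/-! ### Two generators suffice in degree at least three -/

omit [CharP k 2] in
-- The possibly nonzero products of two letters are CA, AB, AC and BA. The first three are `A + C`
-- times `A`, `B`, `C`, because AA = CB = CC = 0.
theorem gens_mul_gens_le : S.gens * S.gens ≤ S.sums * S.gens := by
  have hA : S.A ∈ S.gens := S.letters_le 0 S.A_mem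
  have hB : S.B ∈ S.gens := S.letters_le 1 S.B_mem
  have hC : S.C ∈ S.gens := S.letters_le 1 S.C_mem
  have hP : S.A + S.C ∈ S.sums := Submodule.subset_span (by simp)
  have hQ : S.B ∈ S.sums := Submodule.subset_span (by simp)
  have hAA := Submodule.mul_mem_mul hP hA
  have hAB := Submodule.mul_mem_mul hP hB
  have hAC := Submodule.mul_mem_mul hP hC
  have hBA := Submodule.mul_mem_mul hQ hA
  rw [add_mul] at hAA hAB hAC
  rw [S.A_mul_A, zero_add] at hAA
  rw [S.C_mul_B, add_zero] at hAB
  rw [S.C_mul_C, add_zero] at hAC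
  rw [gens, Submodule.span_mul_span, Submodule.span_le, ← gens]
  rintro _ ⟨x, rfl | rfl | rfl, y, rfl | rfl | rfl, rfl⟩
  all_goals simp [S.A_mul_A, S.B_mul_B, S.C_mul_C, S.B_mul_C, S.C_mul_B, *]

omit [CharP k 2] in
theorem gens_pow_succ_eq_sums_mul (n : ℕ) : S.gens ^ (n + 2) = S.sums * S.gens ^ (n + 1) := by
  apply le_antisymm
  · rw [pow_succ', pow_succ', ← mul_assoc, ← mul_assoc]
    exact mul_le_mul' S.gens_mul_gens_le le_rfl
  · rw [pow_succ' _ (n + 1)]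
    exact mul_le_mul' S.sums_le le_rfl

/-- The relation `D * A * D = 0`, where `D = B + C`. -/
theorem relation : (S.B + S.C) * (S.A * (S.B + S.C)) = 0 := by
  -- The matrix of D is diag(2`A`, `B` + 2`C`), so only the lower diagonal entry of DAD can survive,
  -- and it is `B` * `B` = 0.
  have hD : S.Φ (S.B + S.C) = Matrix.diagonal ![0, S.B] := by
    rw [map_add, Φ_B, Φ_C]
    ext i j
    fin_cases i <;> fin_cases j <;> simp [S.add_self, add_comm S.B, ← add_assoc]
  refine S.Φ_ext fun i j => ?_
  rw [map_mul, hD, Matrix.diagonal_mul, Φ_A_mul, hD, map_zero, Matrix.zero_apply]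
  fin_cases i <;> fin_cases j <;> simp [S.B_mul_B]

/-- Write P = `A + C` and Q = `B`. It suffices to place PPC = CAC and QPC = BAC in the cube of
`sums`. The latter is QPP. Expanding DAD = 0 expresses CAC through BAB = QPQ, BAC = QPP and CAB =
PPQ. -/
theorem sums_pow_three : S.sums ^ 3 = S.gens ^ 3 := by
  apply le_antisymm (pow_le_pow_left' S.sums_le 3)
  rw [gens_pow_succ_eq_sums_mul, gens_pow_succ_eq_sums_mul, zero_add, pow_one, ← mul_assoc,
    pow_succ, pow_two]
  have hP : S.A + S.C ∈ S.sums := Submodule.subset_span (by simp)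
  have hQ : S.B ∈ S.sums := Submodule.subset_span (by simp)
  have hg : S.gens ≤ S.sums ⊔ Submodule.span k {S.C} := by
    have hC : S.C ∈ S.sums ⊔ Submodule.span k {S.C} :=
      Submodule.mem_sup_right (Submodule.mem_span_singleton_self _)
    have hA := sub_mem (Submodule.mem_sup_left (T := Submodule.span k {S.C}) hP) hC
    rw [add_sub_cancel_right] at hA
    rw [gens, Submodule.span_le]
    rintro _ (rfl | rfl | rfl)
    exacts [hA, Submodule.mem_sup_left hQ, hC]
  refine (mul_le_mul' le_rfl hg).trans ?_
  rw [Submodule.mul_sup]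
  refine sup_le le_rfl ?_
  have hPPQ := Submodule.mul_mem_mul (Submodule.mul_mem_mul hP hP) hQ
  have hQPP := Submodule.mul_mem_mul (Submodule.mul_mem_mul hQ hP) hP
  have hQPQ := Submodule.mul_mem_mul (Submodule.mul_mem_mul hQ hP) hQ
  have hneg := neg_mem (add_mem (add_mem hQPQ hQPP) hPPQ)
  have hrel := S.relation
  simp only [add_mul, mul_add, mul_assoc, S.C_mul_B, S.C_mul_C, S.B_mul_C,
    S.A_mul_A, mul_zero, zero_add, add_zero] at hneg hQPP hrel
  have hCAC : S.C * (S.A * S.C) =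
      -(S.B * (S.A * S.B) + S.B * (S.A * S.C) + S.C * (S.A * S.B)) := by
    rw [eq_neg_iff_add_eq_zero, ← hrel]; abel
  rw [← hCAC] at hneg
  nth_rw 1 2 [sums]
  rw [Submodule.span_mul_span, Submodule.span_mul_span, Submodule.span_le]
  rintro _ ⟨_, ⟨x, rfl | rfl, y, rfl | rfl, rfl⟩, z, rfl, rfl⟩
  all_goals simp only [add_mul, mul_add, mul_assoc, S.C_mul_B, S.C_mul_C,
    S.B_mul_C, S.B_mul_B, S.A_mul_A, mul_zero, zero_mul, zero_add, add_zero, SetLike.mem_coe, zero_mem,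
    hneg, hQPP]

theorem sums_pow_eq (n : ℕ) : S.sums ^ (n + 3) = S.gens ^ (n + 3) := by
  induction n with
  | zero => exact S.sums_pow_three
  | succ n ih => rw [pow_succ' _ (n + 3), ih, ← gens_pow_succ_eq_sums_mul]

end GrigorchukModel

/-! ### Sequences with quadratic bounds -/

theorem hasPolynomialGrowth_two_of_bounds {f : ℕ → ℕ} {a b c d : ℝ} (ha : 0 < a) (hc : 0 < c)
    (hl : ∀ n : ℕ, a * (n : ℝ) ^ 2 - b ≤ f n) (hu : ∀ n : ℕ, (f n : ℝ) ≤ c * (n : ℝ) ^ 2 + d) :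
    HasPolynomialGrowth 2 f := by
  refine ⟨.C a * .X ^ 2 + .C 0 * .X + .C (-b), .C c * .X ^ 2 + .C 0 * .X + .C d,
    Polynomial.natDegree_quadratic ha.ne', Polynomial.natDegree_quadratic hc.ne', ?_, ?_,
    fun n => ⟨?_, ?_⟩⟩
  · rwa [Polynomial.leadingCoeff_quadratic ha.ne']
  · rwa [Polynomial.leadingCoeff_quadratic hc.ne']
  · simpa [← sub_eq_add_neg] using hl n
  · simpa using hu n

/-- For large n the constants are absorbed: f lies between (a/2)n² and (c + 1)n². The quotient of
logarithms is then squeezed between two expressions 2 + r / log n, so the lower limit is a limit. -/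
theorem gkDim_eq_two_of_bounds {f : ℕ → ℕ} {a b c d : ℝ} (ha : 0 < a) (hc : 0 < c)
    (hl : ∀ n : ℕ, a * (n : ℝ) ^ 2 - b ≤ f n) (hu : ∀ n : ℕ, (f n : ℝ) ≤ c * (n : ℝ) ^ 2 + d) :
    gkDim f = 2 := by
  have hlog : Tendsto (fun n : ℕ => Real.log n) atTop atTop :=
    Real.tendsto_log_atTop.comp tendsto_natCast_atTop_atTop
  have hsq : Tendsto (fun n : ℕ => (n : ℝ) ^ 2) atTop atTop :=
    (tendsto_pow_atTop two_ne_zero).comp tendsto_natCast_atTop_atTop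
  have h1 : ∀ᶠ n : ℕ in atTop, b / (a / 2) ≤ (n : ℝ) ^ 2 := hsq.eventually_ge_atTop _
  have h2 : ∀ᶠ n : ℕ in atTop, d ≤ (n : ℝ) ^ 2 := hsq.eventually_ge_atTop _
  have h3 : ∀ᶠ n : ℕ in atTop, 2 ≤ n := eventually_ge_atTop 2
  have hlim : ∀ r : ℝ, Tendsto (fun n : ℕ => 2 + r / Real.log n) atTop (nhds 2) := fun r => by
    simpa using (hlog.const_div_atTop r).const_add 2
  have key : Tendsto (fun n : ℕ => Real.log (f n) / Real.log n) atTop (nhds 2) := by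
    refine tendsto_of_tendsto_of_tendsto_of_le_of_le' (hlim (Real.log (a / 2)))
      (hlim (Real.log (c + 1))) ?_ ?_
    · filter_upwards [h1, h3] with n hn hn2
      have hn0 : (0 : ℝ) < n := by exact_mod_cast (by omega : 0 < n)
      have hpos : 0 < Real.log n := Real.log_pos (by exact_mod_cast (by omega : 1 < n))
      rw [div_le_iff₀ (by positivity)] at hn
      have hle : a / 2 * (n : ℝ) ^ 2 ≤ f n := le_trans (by linarith) (hl n)
      have := Real.log_le_log (by positivity) hle
      rw [Real.log_mul (by positivity) (by positivity), Real.log_pow] at this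
      rw [le_div_iff₀ hpos, add_mul, div_mul_cancel₀ _ hpos.ne']
      push_cast at this
      linarith
    · filter_upwards [h1, h2, h3] with n hn hn' hn2
      have hn0 : (0 : ℝ) < n := by exact_mod_cast (by omega : 0 < n)
      have hpos : 0 < Real.log n := Real.log_pos (by exact_mod_cast (by omega : 1 < n))
      rw [div_le_iff₀ (by positivity)] at hn
      have hf : 0 < (f n : ℝ) :=
        lt_of_lt_of_le (by positivity) (le_trans (by linarith : a / 2 * (n : ℝ) ^ 2 ≤ _) (hl n))
      have hle : (f n : ℝ) ≤ (c + 1) * (n : ℝ) ^ 2 := (hu n).trans (by linarith)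
      have := Real.log_le_log hf hle
      rw [Real.log_mul (by positivity) (by positivity), Real.log_pow] at this
      rw [div_le_iff₀ hpos, add_mul, div_mul_cancel₀ _ hpos.ne']
      push_cast at this
      linarith
  have := ((continuous_coe_real_ereal.tendsto 2).comp key).liminf_eq
  exact this

/-! ### Filtrations by powers of a subspace -/

section PartialSum

variable {k A : Type*} [Field k] [Ring A] [Algebra k A]

theorem partialSum_mono (V : ℕ → Submodule k A) : Monotone (partialSum k V) :=
  fun _ _ h => iSup₂_le fun i hi => le_iSup₂_of_le i (hi.trans h) le_rfl

theorem le_partialSum (V : ℕ → Submodule k A) {i n : ℕ} (h : i ≤ n) : V i ≤ partialSum k V n :=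
  le_iSup₂_of_le i h le_rfl

theorem partialSum_zero (V : ℕ → Submodule k A) : partialSum k V 0 = V 0 :=
  le_antisymm (iSup₂_le fun i hi => by rw [Nat.le_zero.1 hi]) (le_partialSum V le_rfl)

theorem partialSum_succ (V : ℕ → Submodule k A) (n : ℕ) :
    partialSum k V (n + 1) = partialSum k V n ⊔ V (n + 1) := by
  apply le_antisymm
  · refine iSup₂_le fun i hi => ?_
    rcases Nat.lt_or_eq_of_le hi with h | rfl
    · exact (le_partialSum V (Nat.lt_succ_iff.1 h)).trans le_sup_left
    · exact le_sup_right
  · exact sup_le (partialSum_mono V n.le_succ) (le_partialSum V le_rfl)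

theorem partialSum_pow_mul_le (N : Submodule k A) (m n : ℕ) :
    partialSum k (fun i => N ^ i) m * partialSum k (fun i => N ^ i) n ≤
      partialSum k (fun i => N ^ i) (m + n) := by
  simp only [partialSum, Submodule.iSup_mul, Submodule.mul_iSup, ← pow_add]
  exact iSup₂_le fun i hi => iSup₂_le fun j hj => le_iSup₂_of_le (j + i) (by omega) le_rfl

theorem pow_partialSum_le (N : Submodule k A) (c n : ℕ) :
    partialSum k (fun i => N ^ i) c ^ n ≤ partialSum k (fun i => N ^ i) (c * n) := by
  induction n with
  | zero =>
    rw [pow_zero]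
    exact (pow_zero N).symm.le.trans (le_partialSum (fun i => N ^ i) (Nat.zero_le _))
  | succ n ih =>
    rw [pow_succ]
    exact (mul_le_mul' ih le_rfl).trans (partialSum_pow_mul_le N _ _)

/-- The stages exhaust the algebra, so the finite set s lies in a single stage C; an n-fold product
then lies in stage C * n. -/
theorem exists_partialSum_le {s : Set A} (hs : s.Finite) {N : Submodule k A}
    (hN : ⨆ n, N ^ n = ⊤) :
    ∃ c, 0 < c ∧ ∀ n, partialSum k (productSpan k s) n ≤ partialSum k (fun i => N ^ i) (c * n) := by
  have hmem : ∀ x : A, ∃ c, x ∈ partialSum k (fun i => N ^ i) c := fun x => by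
    have hx : x ∈ ⨆ n, partialSum k (fun i => N ^ i) n :=
      iSup_mono (fun n => le_partialSum (fun i => N ^ i) le_rfl) (hN ▸ Submodule.mem_top)
    exact (Submodule.mem_iSup_of_directed _ (partialSum_mono _).directed_le).1 hx
  choose c hc using hmem
  -- The added 1 makes the constant positive even when the supremum is 0; positivity is needed later
  -- to divide by it.
  set C := hs.toFinset.sup c + 1
  have hle : Submodule.span k s ≤ partialSum k (fun i => N ^ i) C := by
    rw [Submodule.span_le]
    exact fun x hx => partialSum_mono _
      ((Finset.le_sup (hs.mem_toFinset.2 hx)).trans (Nat.le_succ _)) (hc x)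
  refine ⟨C, Nat.succ_pos _, fun n => iSup₂_le fun i hi => ?_⟩
  exact (pow_le_pow_left' hle i).trans ((pow_partialSum_le N C i).trans
    (partialSum_mono _ (Nat.mul_le_mul_left _ hi)))

end PartialSum

/-! ### The Hilbert function and its growth -/

namespace GrigorchukModel

variable {k R : Type*} [Field k] [Ring R] [Algebra k R] (S : GrigorchukModel k R)

/-- The dimension of the homogeneous component of degree `n`. -/
noncomputable def dim (n : ℕ) : ℕ := Module.finrank k ↑(S.gens ^ n)

/-- The dimension of the sum of the homogeneous components of degree at most `n`. -/
noncomputable def filtrationDim (n : ℕ) : ℕ :=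
  Module.finrank k (partialSum k (fun i => S.gens ^ i) n)

instance finite_partialSum (n : ℕ) :
    Module.Finite k (partialSum k (fun i => S.gens ^ i) n) := by
  induction n with
  | zero =>
    rw [partialSum_zero]
    infer_instance
  | succ n ih => rw [partialSum_succ]; infer_instance

variable [CharP k 2]

theorem dim_eq_sumDim (n : ℕ) : S.sumDim (n + 3) = S.dim (n + 3) := by
  rw [sumDim, sums_pow_eq, dim]

theorem dim_odd (m : ℕ) : S.dim (2 * m + 1) = S.sumDim m + S.sumDim (m + 1) :=
  S.finrank_gens_pow_odd' m

theorem dim_even (m : ℕ) : S.dim (2 * (m + 1)) = 2 * S.sumDim (m + 1) :=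
  S.finrank_gens_pow_even' m

omit [CharP k 2] in
theorem dim_zero : S.dim 0 = 1 := by rw [← S.sumDim_zero, dim, sumDim, pow_zero, pow_zero]

theorem dim_one : S.dim 1 = 3 := by
  simpa [S.sumDim_zero, S.sumDim_one] using S.dim_odd 0

theorem dim_two : S.dim 2 = 4 := by simpa [S.sumDim_one] using S.dim_even 0

theorem dim_three : S.dim 3 = 5 := by
  simpa [S.sumDim_one, S.sumDim_two] using S.dim_odd 1

theorem dim_four : S.dim 4 = 6 := by simpa [S.sumDim_two] using S.dim_even 1

theorem dim_five : S.dim 5 = 8 := by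
  simpa [S.sumDim_two, S.dim_eq_sumDim 0, S.dim_three] using S.dim_odd 2

theorem dim_two_mul {m : ℕ} (hm : 3 ≤ m) : S.dim (2 * m) = 2 * S.dim m := by
  obtain ⟨l, rfl⟩ := Nat.exists_eq_add_of_le' hm
  rw [← dim_eq_sumDim]
  exact S.dim_even (l + 2)

theorem dim_two_mul_add_one {m : ℕ} (hm : 3 ≤ m) :
    S.dim (2 * m + 1) = S.dim m + S.dim (m + 1) := by
  obtain ⟨l, rfl⟩ := Nat.exists_eq_add_of_le' hm
  rw [dim_odd, dim_eq_sumDim, show l + 3 + 1 = l + 1 + 3 by ring, dim_eq_sumDim]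

/-- Denominators are cleared to stay in the natural numbers. The recursion doubles a function and
interpolates linearly at odd arguments, while the breakpoints 2^j and (3/2)2^j double with j; each
linear piece is thus inherited from the previous scale. -/
theorem dim_formula (n j : ℕ) (hn : 3 ≤ n) :
    (2 ^ j ≤ n → 2 * n ≤ 3 * 2 ^ j → 2 * S.dim n + 2 ^ j = 4 * n) ∧
      (3 * 2 ^ j ≤ 2 * n → n ≤ 2 ^ (j + 1) → S.dim n = n + 2 ^ j) := by
  induction n using Nat.strong_induction_on generalizing j with
  | _ n ih =>
    have hbase : n ≤ 5 → (2 ^ j ≤ n → 2 * n ≤ 3 * 2 ^ j → 2 * S.dim n + 2 ^ j = 4 * n) ∧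
        (3 * 2 ^ j ≤ 2 * n → n ≤ 2 ^ (j + 1) → S.dim n = n + 2 ^ j) := fun h5 => by
      have h3 := S.dim_three
      have h4 := S.dim_four
      have h5' := S.dim_five
      rcases j with _ | _ | _ | j
      all_goals
        simp only [pow_succ, pow_zero, one_mul, zero_add]
        try have := Nat.one_le_two_pow (n := j)
        obtain rfl | rfl | rfl : n = 3 ∨ n = 4 ∨ n = 5 := by omega
        all_goals omega
    rcases Nat.lt_or_ge 5 n with h6 | h5
    · rcases j with _ | j
      · simp only [pow_succ, pow_zero]; omega
      obtain ⟨m, rfl | rfl⟩ := Nat.even_or_odd' n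
      · have h := ih m (by omega) j (by omega)
        rw [S.dim_two_mul (by omega)]
        simp only [pow_succ] at h ⊢
        omega
      · rw [S.dim_two_mul_add_one (by omega)]
        have h := ih m (by omega) j (by omega)
        have h' := ih (m + 1) (by omega) j (by omega)
        -- At the smallest scale the ranges end at 4, below n. Otherwise the midpoint 3 * 2^j of the
        -- halved range is an integer, so m and m + 1 lie on a common linear piece.
        rcases j with _ | j
        · simp only [pow_succ, pow_zero] at h h' ⊢; omega
        simp only [pow_succ] at h h' ⊢
        omega
    · exact hbase h5

theorem dim_bounds {n : ℕ} (hn : 3 ≤ n) : n ≤ S.dim n ∧ S.dim n ≤ 2 * n := by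
  induction n using Nat.strong_induction_on with
  | _ n ih =>
    rcases Nat.lt_or_ge 5 n with h6 | h5
    · obtain ⟨m, rfl | rfl⟩ := Nat.even_or_odd' n
      · have := ih m (by omega) (by omega)
        rw [S.dim_two_mul (by omega)]
        omega
      · have := ih m (by omega) (by omega)
        have := ih (m + 1) (by omega) (by omega)
        rw [S.dim_two_mul_add_one (by omega)]
        omega
    · obtain rfl | rfl | rfl : n = 3 ∨ n = 4 ∨ n = 5 := by omega
      · simp [S.dim_three]
      · simp [S.dim_four]
      · simp [S.dim_five]

theorem le_dim (n : ℕ) : n ≤ S.dim n := by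
  rcases Nat.lt_or_ge n 3 with h | h
  · obtain rfl | rfl | rfl : n = 0 ∨ n = 1 ∨ n = 2 := by omega
    · exact Nat.zero_le _
    · simp [S.dim_one]
    · simp [S.dim_two]
  · exact (S.dim_bounds h).1

theorem dim_le (n : ℕ) : S.dim n ≤ 2 * n + 1 := by
  rcases Nat.lt_or_ge n 3 with h | h
  · obtain rfl | rfl | rfl : n = 0 ∨ n = 1 ∨ n = 2 := by omega
    · simp [S.dim_zero]
    · simp [S.dim_one]
    · simp [S.dim_two]
  · exact (S.dim_bounds h).2.trans (Nat.le_succ _)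

omit [CharP k 2] in
theorem filtrationDim_zero : S.filtrationDim 0 = 1 := by
  rw [← S.dim_zero, filtrationDim, partialSum_zero, dim]

theorem filtrationDim_succ (n : ℕ) :
    S.filtrationDim (n + 1) = S.filtrationDim n + S.dim (n + 1) := by
  rw [filtrationDim, partialSum_succ, Submodule.finrank_sup_of_disjoint]
  · rfl
  · exact (S.disjoint_gens_pow_of_le
      (iSup₂_le fun i hi => le_iSup₂_of_le i (by omega) le_rfl)).symm

theorem filtrationDim_bounds (n : ℕ) :
    n ^ 2 ≤ 2 * S.filtrationDim n ∧ S.filtrationDim n ≤ (n + 1) ^ 2 := by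
  induction n with
  | zero => simp [S.filtrationDim_zero]
  | succ n ih =>
    rw [filtrationDim_succ]
    have h1 := S.le_dim (n + 1)
    have h2 := S.dim_le (n + 1)
    constructor <;> nlinarith

theorem filtrationDim_ge (n : ℕ) : (n : ℝ) ^ 2 / 2 ≤ S.filtrationDim n := by
  have h : (n : ℝ) ^ 2 ≤ 2 * S.filtrationDim n := by exact_mod_cast (S.filtrationDim_bounds n).1
  linarith

theorem filtrationDim_le (n : ℕ) : (S.filtrationDim n : ℝ) ≤ 2 * (n : ℝ) ^ 2 + 2 := by
  have h : (S.filtrationDim n : ℝ) ≤ ((n : ℝ) + 1) ^ 2 := by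
    exact_mod_cast (S.filtrationDim_bounds n).2
  nlinarith [sq_nonneg ((n : ℝ) - 1)]

theorem filtrationDim_growth :
    HasPolynomialGrowth 2 S.filtrationDim ∧ gkDim S.filtrationDim = 2 := by
  have hl : ∀ n : ℕ, 1 / 2 * (n : ℝ) ^ 2 - 0 ≤ S.filtrationDim n := fun n => by
    linarith [S.filtrationDim_ge n]
  exact ⟨hasPolynomialGrowth_two_of_bounds one_half_pos two_pos hl S.filtrationDim_le,
    gkDim_eq_two_of_bounds one_half_pos two_pos hl S.filtrationDim_le⟩

include S in
-- The filtration of s and the filtration by degree are each contained in a linear rescaling of the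
-- other, which preserves quadratic bounds.
theorem growth_of_finite {s : Set R} (hs : s.Finite) (htop : Algebra.adjoin k s = ⊤) :
    HasPolynomialGrowth 2 (fun n => Module.finrank k (partialSum k (productSpan k s) n)) ∧
      gkDim (fun n => Module.finrank k (partialSum k (productSpan k s) n)) = 2 := by
  obtain ⟨c, hc, hcle⟩ := exists_partialSum_le hs S.iSup_gens_pow
  have htop' : ⨆ n, Submodule.span k s ^ n = ⊤ := by
    rw [← top_le_iff, ← Algebra.top_toSubmodule, ← htop]
    exact Algebra.toSubmodule_adjoin_le_iSup_span_pow _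
  obtain ⟨e, he, hele⟩ := exists_partialSum_le (s := {S.A, S.B, S.C}) (by simp) htop'
  change ∀ n, partialSum k (fun i => S.gens ^ i) n ≤ partialSum k (productSpan k s) (e * n) at hele
  have hfin : ∀ n, Module.Finite k (partialSum k (productSpan k s) n) := fun n =>
    Submodule.finiteDimensional_of_le (hcle n)
  have hc' : (0 : ℝ) < c := by exact_mod_cast hc
  have he' : (0 : ℝ) < e := by exact_mod_cast he
  have hu : ∀ n : ℕ, (Module.finrank k (partialSum k (productSpan k s) n) : ℝ) ≤
      2 * (c : ℝ) ^ 2 * (n : ℝ) ^ 2 + 2 := fun n => by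
    have h1 : (Module.finrank k (partialSum k (productSpan k s) n) : ℝ) ≤
        S.filtrationDim (c * n) := by exact_mod_cast Submodule.finrank_mono (hcle n)
    have h2 := S.filtrationDim_le (c * n)
    push_cast at h2
    linarith [mul_pow (c : ℝ) n 2]
  -- With q the integer part of n/e, the dimension is at least q²/2. Since n/e ≤ q + 1 and (q + 1)²
  -- ≤ 2q² + 2, this is at least (n/e)²/4 - 1/2.
  have hl : ∀ n : ℕ, 1 / (4 * (e : ℝ) ^ 2) * (n : ℝ) ^ 2 - 1 / 2 ≤
      (Module.finrank k (partialSum k (productSpan k s) n) : ℝ) := fun n => by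
    have h1 : (S.filtrationDim (n / e) : ℝ) ≤
        Module.finrank k (partialSum k (productSpan k s) n) := by
      exact_mod_cast Submodule.finrank_mono
        ((hele (n / e)).trans (partialSum_mono _ (Nat.mul_div_le n e)))
    refine le_trans ?_ ((S.filtrationDim_ge (n / e)).trans h1)
    have h2 : (n : ℝ) / e ≤ ((n / e : ℕ) : ℝ) + 1 := by
      rw [div_le_iff₀ he']
      have := Nat.lt_mul_div_succ n he
      have h3 : (n : ℝ) < e * (((n / e : ℕ) : ℝ) + 1) := by exact_mod_cast this
      linarith
    have h3 : (0 : ℝ) ≤ (n : ℝ) / e := by positivity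
    have h4 : 1 / (4 * (e : ℝ) ^ 2) * (n : ℝ) ^ 2 = ((n : ℝ) / e) ^ 2 / 4 := by
      field_simp
    rw [h4]
    have h5 : ((n : ℝ) / e) ^ 2 ≤ (((n / e : ℕ) : ℝ) + 1) ^ 2 := pow_le_pow_left₀ h3 h2 2
    nlinarith [sq_nonneg (((n / e : ℕ) : ℝ) - 1)]
  exact ⟨hasPolynomialGrowth_two_of_bounds (by positivity) (by positivity) hl hu,
    gkDim_eq_two_of_bounds (by positivity) (by positivity) hl hu⟩

/-! ### The grading -/

theorem nonempty_gradedAlgebra : Nonempty (GradedAlgebra fun n => S.gens ^ n) :=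
  have h := DirectSum.isInternal_submodule_of_iSupIndep_of_iSup_eq_top S.iSupIndep_gens_pow
    S.iSup_gens_pow
  ⟨{ Submodule.nat_power_gradedMonoid S.gens, h.chooseDecomposition with }⟩

omit [CharP k 2] in
theorem ker_ε_restrictScalars :
    (RingHom.ker S.ε : Ideal R).restrictScalars k = ⨆ m ≥ 1, S.gens ^ m := by
  apply le_antisymm
  · intro x hx
    have hx' : x ∈ S.gens ^ 0 ⊔ ⨆ m ≥ 1, S.gens ^ m := by
      have : (⊤ : Submodule k R) ≤ S.gens ^ 0 ⊔ ⨆ m ≥ 1, S.gens ^ m := by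
        rw [← S.iSup_gens_pow]
        refine iSup_le fun m => ?_
        rcases Nat.eq_zero_or_pos m with rfl | hm
        · exact le_sup_left
        · exact le_sup_of_le_right (le_iSup₂_of_le m hm le_rfl)
      exact this Submodule.mem_top
    obtain ⟨y, hy, z, hz, rfl⟩ := Submodule.mem_sup.1 hx'
    have hz0 : S.ε z = 0 := by
      have : ⨆ m ≥ 1, S.gens ^ m ≤ LinearMap.ker S.ε.toLinearMap := by
        refine iSup₂_le fun m hm w hw => ?_
        obtain ⟨l, rfl⟩ := Nat.exists_eq_add_of_le' hm
        exact S.ε_of_mem_gens_pow hw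
      exact this hz
    rw [pow_zero, Submodule.mem_one] at hy
    obtain ⟨c, rfl⟩ := hy
    have hc : S.ε (algebraMap k R c + z) = 0 := hx
    rw [map_add, hz0, AlgHom.commutes, add_zero] at hc
    have hc0 : c = 0 := hc
    rw [hc0, map_zero, zero_add]
    exact hz
  · refine iSup₂_le fun m hm x hx => ?_
    obtain ⟨l, rfl⟩ := Nat.exists_eq_add_of_le' hm
    exact S.ε_of_mem_gens_pow hx

omit [CharP k 2] in
theorem ker_ε_pow_restrictScalars (n : ℕ) :
    ((RingHom.ker S.ε : Ideal R) ^ n).restrictScalars k = ⨆ m ≥ n, S.gens ^ m := by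
  induction n with
  | zero =>
    rw [Submodule.pow_zero, Ideal.one_eq_top, Submodule.restrictScalars_top, ← S.iSup_gens_pow]
    simp
  | succ n ih =>
    rw [Submodule.pow_succ, Ideal.restrictScalars_mul, ih, ker_ε_restrictScalars]
    simp only [Submodule.iSup_mul, Submodule.mul_iSup, ← pow_add]
    apply le_antisymm
    · exact iSup₂_le fun i hi => iSup₂_le fun j hj => le_iSup₂_of_le (j + i) (by omega) le_rfl
    · refine iSup₂_le fun i hi => ?_
      refine le_iSup₂_of_le 1 le_rfl (le_iSup₂_of_le (i - 1) (by omega) ?_)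
      rw [show i - 1 + 1 = i by omega]

/-- The n-th power of the ideal consists of all degrees at least n, so degree n is a complement of
the next power. -/
theorem powerQuotientDim_eq (n : ℕ) : powerQuotientDim k R (RingHom.ker S.ε) n = S.dim n := by
  set I : Ideal R := RingHom.ker S.ε
  have hle : S.gens ^ n ≤ (I ^ n).restrictScalars k := by
    rw [ker_ε_pow_restrictScalars]
    exact le_iSup₂_of_le n le_rfl le_rfl
  let g : ↑(S.gens ^ n) →ₗ[k] ↥(I ^ n) ⧸ (I ^ (n + 1)).submoduleOf (I ^ n) :=
    ((I ^ (n + 1)).submoduleOf (I ^ n)).mkQ.restrictScalars k ∘ₗ Submodule.inclusion hle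
  have hg : Function.Bijective g := by
    constructor
    · rw [← LinearMap.ker_eq_bot, LinearMap.ker_eq_bot']
      rintro ⟨x, hx⟩ h
      have hm : (⟨x, hle hx⟩ : ↥(I ^ n)) ∈ (I ^ (n + 1)).submoduleOf (I ^ n) :=
        (Submodule.Quotient.mk_eq_zero _).1 h
      have h' : x ∈ (I ^ (n + 1)).restrictScalars k := hm
      rw [ker_ε_pow_restrictScalars] at h'
      exact Subtype.ext (Submodule.disjoint_def.1 (S.disjoint_gens_pow_of_le
        (iSup₂_le fun i hi => le_iSup₂_of_le i (by omega) le_rfl)) x hx h')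
    · intro q
      obtain ⟨⟨y, hy⟩, rfl⟩ := Submodule.Quotient.mk_surjective _ q
      have hy' : y ∈ (I ^ n).restrictScalars k := hy
      have hsup : (I ^ n).restrictScalars k ≤
          S.gens ^ n ⊔ (I ^ (n + 1)).restrictScalars k := by
        rw [ker_ε_pow_restrictScalars, ker_ε_pow_restrictScalars]
        refine iSup₂_le fun i hi => ?_
        rcases Nat.eq_or_lt_of_le hi with rfl | h
        · exact le_sup_left
        · exact le_sup_of_le_right (le_iSup₂_of_le i h le_rfl)
      obtain ⟨x, hx, z, hz, rfl⟩ := Submodule.mem_sup.1 (hsup hy')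
      refine ⟨⟨x, hx⟩, (Submodule.Quotient.eq _).2 ?_⟩
      change x - (x + z) ∈ I ^ (n + 1)
      rw [sub_add_cancel_left]
      exact neg_mem hz
  exact (LinearEquiv.ofBijective g hg).finrank_eq.symm

end GrigorchukModel

/-! ### The matrix recursion of the Grigorchuk group -/

namespace Grigorchuk

/-- The word obtained by adding a letter in front. -/
def cons (i : Fin 2) (x : Ray) : Ray
  | 0 => i
  | n + 1 => x n

/-- The word obtained by removing the first letter. -/
def tail (x : Ray) : Ray := fun n => x (n + 1)

theorem cons_zero (i : Fin 2) (x : Ray) : cons i x 0 = i := rfl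

theorem tail_cons (i : Fin 2) (x : Ray) : tail (cons i x) = x := rfl

theorem cons_tail (x : Ray) : cons (x 0) (tail x) = x := by
  funext n
  cases n <;> rfl

theorem act_a_cons (i : Fin 2) (x : Ray) : act .a (cons i x) = cons (i + 1) x := by
  funext n
  cases n with
  | zero => fin_cases i <;> simp [act, cons]
  | succ n => rfl

theorem act_cons_zero (x : Ray) :
    act .b (cons 0 x) = cons 0 (act .a x) ∧ act .c (cons 0 x) = cons 0 (act .a x) ∧
      act .d (cons 0 x) = cons 0 x := by
  refine ⟨?_, ?_, ?_⟩ <;> funext n <;> cases n <;> simp [act, cons]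

theorem act_cons_one (x : Ray) :
    act .b (cons 1 x) = cons 1 (act .c x) ∧ act .c (cons 1 x) = cons 1 (act .d x) ∧
      act .d (cons 1 x) = cons 1 (act .b x) := by
  refine ⟨?_, ?_, ?_⟩ <;> funext n <;> cases n <;> simp [act, cons]

/-- If the first 0 of the ray comes after r letters 1, then `b`, `c`, `d` can change only the letter
following that 0. Two of them apply `a` there and the third acts trivially; which one is trivial
depends on r mod 3. -/
theorem act_eq (x : Ray) :
    (act .b x = x ∧ act .c x = act .d x) ∨ (act .c x = x ∧ act .b x = act .d x) ∨
      (act .d x = x ∧ act .b x = act .c x) := by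
  by_cases h : ∃ n, x n = 0
  · obtain ⟨n, hn⟩ := h
    induction n generalizing x with
    | zero =>
      rw [← cons_tail x, hn, (act_cons_zero _).1, (act_cons_zero _).2.1, (act_cons_zero _).2.2]
      exact Or.inr (Or.inr ⟨rfl, rfl⟩)
    | succ n ih =>
      have h2 : x 0 = 0 ∨ x 0 = 1 := by omega
      rw [← cons_tail x]
      rcases h2 with h0 | h1
      · rw [h0, (act_cons_zero _).1, (act_cons_zero _).2.1, (act_cons_zero _).2.2]
        exact Or.inr (Or.inr ⟨rfl, rfl⟩)
      · rw [h1, (act_cons_one _).1, (act_cons_one _).2.1, (act_cons_one _).2.2]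
        rcases ih (tail x) hn with ⟨h, h'⟩ | ⟨h, h'⟩ | ⟨h, h'⟩
        · exact Or.inr (Or.inr ⟨by rw [h], by rw [h']⟩)
        · exact Or.inl ⟨by rw [h], by rw [h']⟩
        · exact Or.inr (Or.inl ⟨by rw [h], by rw [← h']⟩)
  -- On the ray 1, 1, 1, … the recursion never reaches `a`, and all three generators fix it.
  · have key : ∀ n (x : Ray), (∀ n, x n = 1) →
        act .b x n = x n ∧ act .c x n = x n ∧ act .d x n = x n := by
      intro n
      induction n with
      | zero => intro x hx; exact ⟨rfl, rfl, rfl⟩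
      | succ n ih =>
        intro x hx
        have := ih (tail x) fun n => hx (n + 1)
        rw [← cons_tail x, hx 0, (act_cons_one _).1, (act_cons_one _).2.1, (act_cons_one _).2.2]
        exact ⟨this.2.1, this.2.2, this.1⟩
    have hx : ∀ n, x n = 1 := fun n => by
      have := not_exists.1 h n
      omega
    have hb : act .b x = x := funext fun n => (key n x hx).1
    have hc : act .c x = x := funext fun n => (key n x hx).2.1
    have hd : act .d x = x := funext fun n => (key n x hx).2.2
    exact Or.inl ⟨hb, by rw [hc, hd]⟩

/-- All six products are treated at once because passing to the tail after the letter 1 permutes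
`b`, `c`, `d` cyclically. -/
theorem act_act_apply (n : ℕ) (x : Ray) :
    act .b (act .c x) n = act .d x n ∧ act .c (act .b x) n = act .d x n ∧
      act .c (act .d x) n = act .b x n ∧ act .d (act .c x) n = act .b x n ∧
      act .d (act .b x) n = act .c x n ∧ act .b (act .d x) n = act .c x n := by
  induction n generalizing x with
  | zero => exact ⟨rfl, rfl, rfl, rfl, rfl, rfl⟩
  | succ n ih =>
    have h2 : x 0 = 0 ∨ x 0 = 1 := by omega
    rw [← cons_tail x]
    rcases h2 with h | h
    · simp [h, (act_cons_zero _).1, (act_cons_zero _).2.1, (act_cons_zero _).2.2, act_act]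
    · simpa [h, (act_cons_one _).1, (act_cons_one _).2.1, (act_cons_one _).2.2, cons, and_assoc,
        and_comm, and_left_comm] using ih (tail x)

theorem act_b_act_c (x : Ray) : act .b (act .c x) = act .d x :=
  funext fun n => (act_act_apply n x).1

theorem act_c_act_b (x : Ray) : act .c (act .b x) = act .d x :=
  funext fun n => (act_act_apply n x).2.1

variable (k : Type*) [Field k]

/-- The element of the tree enveloping algebra given by a generator of the group. -/
noncomputable def gen (s : Gen) : Alg k :=
  toTreeEnveloping k group
    (MonoidAlgebra.of k group ⟨perm s, Subgroup.subset_closure (Set.mem_range_self s)⟩)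

theorem gen_single (s : Gen) (x : Ray) :
    (gen k s).1 (MonoidAlgebra.single x 1) = MonoidAlgebra.single (act s x) 1 := by
  change permAlgHom k group _ _ = _
  rw [permAlgHom, Representation.asAlgebraHom_of, Representation.ofMulAction_single]
  rfl

variable {k}

theorem alg_ext {S T : Alg k}
    (h : ∀ x, S.1 (MonoidAlgebra.single x 1) = T.1 (MonoidAlgebra.single x 1)) : S = T := by
  apply Subtype.ext
  ext x : 2
  exact h x

theorem mem_adjoin_range_gen (T : Alg k) : T ∈ Algebra.adjoin k (Set.range (gen k)) := by
  obtain ⟨_, x, rfl⟩ := T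
  change toTreeEnveloping k group x ∈ _
  induction x using MonoidAlgebra.induction_on with
  | of g =>
    -- Inverses are carried along so that the inverse step of the closure induction is a swap; the
    -- generators themselves are involutions.
    have key : ∀ g ∈ Subgroup.closure (Set.range perm), ∀ hg : g ∈ group,
        toTreeEnveloping k group (MonoidAlgebra.of k group ⟨g, hg⟩) ∈
            Algebra.adjoin k (Set.range (gen k)) ∧
          toTreeEnveloping k group (MonoidAlgebra.of k group ⟨g, hg⟩⁻¹) ∈
            Algebra.adjoin k (Set.range (gen k)) := by
      intro g hg
      induction hg using Subgroup.closure_induction with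
      | mem g hg =>
        obtain ⟨s, rfl⟩ := hg
        intro hg
        have hinv : (⟨perm s, hg⟩ : group)⁻¹ = ⟨perm s, hg⟩ := Subtype.ext (Equiv.ext fun _ => rfl)
        rw [hinv]
        exact ⟨Algebra.subset_adjoin ⟨s, rfl⟩, Algebra.subset_adjoin ⟨s, rfl⟩⟩
      | one =>
        intro hg
        have h1 : (⟨1, hg⟩ : group) = 1 := rfl
        rw [h1, inv_one, map_one, map_one]
        exact ⟨one_mem _, one_mem _⟩
      | mul g h hg hh ihg ihh =>
        intro hgh
        have h1 : (⟨g * h, hgh⟩ : group) = ⟨g, hg⟩ * ⟨h, hh⟩ := rfl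
        rw [h1, mul_inv_rev, map_mul, map_mul, map_mul, map_mul]
        exact ⟨mul_mem (ihg hg).1 (ihh hh).1, mul_mem (ihh hh).2 (ihg hg).2⟩
      | inv g hg ihg =>
        intro hg'
        have h1 : (⟨g⁻¹, hg'⟩ : group) = ⟨g, hg⟩⁻¹ := rfl
        rw [h1, inv_inv]
        exact (ihg hg).symm
    exact (key g.1 g.2 g.2).1
  | add f h hf hh => rw [map_add]; exact add_mem hf hh
  | smul r f hf => rw [map_smul]; exact Subalgebra.smul_mem _ hf r

/-! ### Entries of operators -/

variable (k)

/-- The map induced by adding a letter in front of all words. -/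
noncomputable def consMap (i : Fin 2) : MonoidAlgebra k Ray →ₗ[k] MonoidAlgebra k Ray :=
  MonoidAlgebra.mapDomainLinearMap k k (cons i)

/-- The map removing the given letter from the words that begin with it, and killing the other
words. -/
noncomputable def tailMap (i : Fin 2) : MonoidAlgebra k Ray →ₗ[k] MonoidAlgebra k Ray :=
  (MonoidAlgebra.basis Ray k).constr k
    fun x => if x 0 = i then MonoidAlgebra.single (tail x) 1 else 0

variable {k}

theorem consMap_single (i : Fin 2) (x : Ray) :
    consMap k i (MonoidAlgebra.single x 1) = MonoidAlgebra.single (cons i x) 1 := by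
  simp [consMap]

theorem tailMap_single (i : Fin 2) (x : Ray) :
    tailMap k i (MonoidAlgebra.single x 1) =
      if x 0 = i then MonoidAlgebra.single (tail x) 1 else 0 := by
  rw [tailMap, ← MonoidAlgebra.basis_apply, Module.Basis.constr_basis]

theorem tailMap_consMap (i j : Fin 2) (v : MonoidAlgebra k Ray) :
    tailMap k i (consMap k j v) = if i = j then v else 0 := by
  have : tailMap k i ∘ₗ consMap k j = if i = j then LinearMap.id else 0 := by
    ext x : 2
    change tailMap k i (consMap k j (MonoidAlgebra.single x 1)) = _
    rw [consMap_single, tailMap_single, cons_zero, tail_cons]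
    by_cases h : i = j
    · simp [h]
    · simp [h, Ne.symm h]
  rw [← LinearMap.comp_apply, this]
  split_ifs <;> rfl

theorem sum_consMap_tailMap (v : MonoidAlgebra k Ray) :
    ∑ i, consMap k i (tailMap k i v) = v := by
  have : ∑ i, consMap k i ∘ₗ tailMap k i = LinearMap.id := by
    ext x : 2
    change (∑ i, consMap k i ∘ₗ tailMap k i) (MonoidAlgebra.single x 1) = MonoidAlgebra.single x 1
    have h2 : x 0 = 0 ∨ x 0 = 1 := by omega
    conv_rhs => rw [← cons_tail x]
    rcases h2 with h | h <;>
      simp [Fin.sum_univ_two, tailMap_single, h, consMap_single]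
  have h := LinearMap.congr_fun this v
  simpa using h

/-- The entries of an operator with respect to the decomposition by the first letter. -/
noncomputable def entryMap (i j : Fin 2) :
    Module.End k (MonoidAlgebra k Ray) →ₗ[k] Module.End k (MonoidAlgebra k Ray) where
  toFun T := tailMap k i ∘ₗ T ∘ₗ consMap k j
  map_add' S T := by rw [LinearMap.add_comp, LinearMap.comp_add]
  map_smul' c T := by rw [LinearMap.smul_comp, LinearMap.comp_smul]; rfl

theorem entryMap_apply (i j : Fin 2) (T : Module.End k (MonoidAlgebra k Ray))
    (v : MonoidAlgebra k Ray) : entryMap i j T v = tailMap k i (T (consMap k j v)) := rfl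

theorem entryMap_one (i j : Fin 2) :
    entryMap i j (1 : Module.End k (MonoidAlgebra k Ray)) = if i = j then 1 else 0 := by
  refine LinearMap.ext fun v => ?_
  rw [entryMap_apply, Module.End.one_apply, tailMap_consMap]
  split_ifs <;> rfl

theorem entryMap_mul (i j : Fin 2) (S T : Module.End k (MonoidAlgebra k Ray)) :
    entryMap i j (S * T) = ∑ l, entryMap i l S * entryMap l j T := by
  refine LinearMap.ext fun v => ?_
  rw [entryMap_apply, Module.End.mul_apply, ← sum_consMap_tailMap (T (consMap k j v))]
  simp [entryMap_apply]

theorem eq_zero_of_entryMap_eq_zero {T : Module.End k (MonoidAlgebra k Ray)}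
    (h : ∀ i j, entryMap i j T = 0) : T = 0 := by
  ext x : 2
  change T (MonoidAlgebra.single x 1) = 0
  rw [← cons_tail x, ← consMap_single, ← sum_consMap_tailMap (T _)]
  refine Finset.sum_eq_zero fun i _ => ?_
  rw [← entryMap_apply, h, LinearMap.zero_apply, map_zero]

theorem entryMap_gen_a (i j : Fin 2) :
    entryMap i j (gen k .a).1 = if i = j then 0 else 1 := by
  ext x : 2
  change entryMap i j (gen k .a).1 (MonoidAlgebra.single x 1) = _
  rw [entryMap_apply, consMap_single, gen_single, act_a_cons, tailMap_single, cons_zero, tail_cons]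
  fin_cases i <;> fin_cases j <;> simp

theorem entryMap_gen_of_cons {s : Gen} {s₀ s₁ : Gen}
    (h₀ : ∀ x, act s (cons 0 x) = cons 0 (act s₀ x))
    (h₁ : ∀ x, act s (cons 1 x) = cons 1 (act s₁ x)) (i j : Fin 2) :
    entryMap i j (gen k s).1 = Matrix.diagonal ![(gen k s₀).1, (gen k s₁).1] i j := by
  ext x : 2
  change entryMap i j (gen k s).1 (MonoidAlgebra.single x 1) =
    Matrix.diagonal ![(gen k s₀).1, (gen k s₁).1] i j (MonoidAlgebra.single x 1)
  rw [entryMap_apply, consMap_single, gen_single]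
  fin_cases i <;> fin_cases j <;>
    simp [h₀, h₁, tailMap_single, cons_zero, tail_cons, gen_single]

theorem entryMap_gen_d (i j : Fin 2) :
    entryMap i j (gen k .d).1 = Matrix.diagonal ![1, (gen k .b).1] i j := by
  ext x : 2
  change entryMap i j (gen k .d).1 (MonoidAlgebra.single x 1) =
    Matrix.diagonal ![1, (gen k .b).1] i j (MonoidAlgebra.single x 1)
  rw [entryMap_apply, consMap_single, gen_single]
  fin_cases i <;> fin_cases j <;>
    simp [(act_cons_zero x).2.2, (act_cons_one x).2.2, tailMap_single, cons_zero, tail_cons,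
      gen_single]

/-- This is self-similarity: entries of generators are generators, 0 or 1, and entries of a product
are sums of products of entries. -/
theorem entryMap_mem (T : Alg k) (i j : Fin 2) :
    entryMap i j T.1 ∈ TreeEnvelopingAlgebra k group := by
  have hT := mem_adjoin_range_gen T
  have hdiag : ∀ S₀ S₁ : Alg k, ∀ i j : Fin 2,
      Matrix.diagonal ![S₀.1, S₁.1] i j ∈ TreeEnvelopingAlgebra k group := fun S₀ S₁ i j => by
    fin_cases i <;> fin_cases j <;> simp
  induction hT using Algebra.adjoin_induction generalizing i j with
  | mem T hT =>
    obtain ⟨s, rfl⟩ := hT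
    cases s with
    | a =>
      rw [entryMap_gen_a]
      split_ifs
      exacts [zero_mem _, one_mem _]
    | b =>
      rw [entryMap_gen_of_cons (fun x => (act_cons_zero x).1) (fun x => (act_cons_one x).1)]
      exact hdiag _ _ i j
    | c =>
      rw [entryMap_gen_of_cons (fun x => (act_cons_zero x).2.1) (fun x => (act_cons_one x).2.1)]
      exact hdiag _ _ i j
    | d =>
      rw [entryMap_gen_d]
      exact hdiag 1 _ i j
  | algebraMap r =>
    have h : (algebraMap k (Alg k) r).1 = r • (1 : Module.End k (MonoidAlgebra k Ray)) :=
      Algebra.algebraMap_eq_smul_one r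
    rw [h, map_smul, entryMap_one]
    refine Subalgebra.smul_mem _ ?_ r
    split_ifs
    exacts [one_mem _, zero_mem _]
  | add S T _ _ hS hT =>
    change entryMap i j (S.1 + T.1) ∈ _
    rw [map_add]
    exact add_mem (hS i j) (hT i j)
  | mul S T _ _ hS hT =>
    change entryMap i j (S.1 * T.1) ∈ _
    rw [entryMap_mul]
    exact sum_mem fun l _ => mul_mem (hS i l) (hT l j)

variable (k)

/-- The matrix recursion of the tree enveloping algebra. -/
noncomputable def recursion : Alg k →ₐ[k] Matrix (Fin 2) (Fin 2) (Alg k) :=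
  AlgHom.ofLinearMap
    { toFun := fun T => Matrix.of fun i j => ⟨entryMap i j T.1, entryMap_mem T i j⟩
      map_add' := fun S T => by ext1 i j; exact Subtype.ext (map_add (entryMap i j) S.1 T.1)
      map_smul' := fun c T => by ext1 i j; exact Subtype.ext (map_smul (entryMap i j) c T.1) }
    (by
      ext1 i j
      apply Subtype.ext
      change entryMap i j 1 = _
      rw [entryMap_one, Matrix.one_apply]
      split_ifs <;> rfl)
    (fun S T => by
      ext1 i j
      apply Subtype.ext
      change entryMap i j (S.1 * T.1) = _
      rw [entryMap_mul, LinearMap.coe_mk, AddHom.coe_mk, Matrix.mul_apply]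
      simp)

variable {k}

theorem recursion_apply (T : Alg k) (i j : Fin 2) :
    (recursion k T i j).1 = entryMap i j T.1 := rfl

theorem recursion_injective : Function.Injective (recursion k) := by
  rw [injective_iff_map_eq_zero]
  intro T hT
  apply Subtype.ext
  refine eq_zero_of_entryMap_eq_zero fun i j => ?_
  rw [← recursion_apply, hT]
  rfl

theorem recursion_gen_a : recursion k (gen k .a) = !![0, 1; 1, 0] := by
  ext1 i j
  apply Subtype.ext
  rw [recursion_apply, entryMap_gen_a]
  fin_cases i <;> fin_cases j <;> rfl

theorem recursion_gen_b : recursion k (gen k .b) = !![gen k .a, 0; 0, gen k .c] := by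
  ext1 i j
  apply Subtype.ext
  rw [recursion_apply,
    entryMap_gen_of_cons (fun x => (act_cons_zero x).1) (fun x => (act_cons_one x).1)]
  fin_cases i <;> fin_cases j <;> rfl

theorem recursion_gen_c : recursion k (gen k .c) = !![gen k .a, 0; 0, gen k .d] := by
  ext1 i j
  apply Subtype.ext
  rw [recursion_apply,
    entryMap_gen_of_cons (fun x => (act_cons_zero x).2.1) (fun x => (act_cons_one x).2.1)]
  fin_cases i <;> fin_cases j <;> rfl

/-! ### Relations between the generators -/

theorem gen_mul_self (s : Gen) : gen k s * gen k s = 1 := by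
  refine alg_ext fun x => ?_
  change (gen k s).1 ((gen k s).1 (MonoidAlgebra.single x 1)) = MonoidAlgebra.single x 1
  rw [gen_single, gen_single, act_act]

theorem gen_b_mul_gen_c : gen k .b * gen k .c = gen k .d := by
  refine alg_ext fun x => ?_
  change (gen k .b).1 ((gen k .c).1 (MonoidAlgebra.single x 1)) = _
  rw [gen_single, gen_single, gen_single, act_b_act_c]

theorem gen_c_mul_gen_b : gen k .c * gen k .b = gen k .d := by
  refine alg_ext fun x => ?_
  change (gen k .c).1 ((gen k .b).1 (MonoidAlgebra.single x 1)) = _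
  rw [gen_single, gen_single, gen_single, act_c_act_b]

theorem augmentation_gen (s : Gen) : augmentation k group (gen k s) = 1 := by
  rw [gen, augmentation_comp]
  simp [groupAugmentation]

section CharTwo

variable [CharP k 2]

theorem add_self_eq_zero {V : Type*} [AddCommGroup V] [Module k V] (x : V) : x + x = 0 := by
  rw [← two_smul k x, CharTwo.two_eq_zero, zero_smul]

/-- On each ray one generator is trivial and the images under the other two coincide, so these
cancel in characteristic 2. The relation concerns operators on rays; it fails in the group algebra,
where distinct group elements are independent. -/
theorem gen_add_gen_add_gen : gen k .b + gen k .c + gen k .d = 1 := by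
  refine alg_ext fun x => ?_
  change (gen k .b).1 (MonoidAlgebra.single x 1) + (gen k .c).1 (MonoidAlgebra.single x 1) +
    (gen k .d).1 (MonoidAlgebra.single x 1) = MonoidAlgebra.single x 1
  simp only [gen_single]
  rcases act_eq x with ⟨h, h'⟩ | ⟨h, h'⟩ | ⟨h, h'⟩
  · rw [h, h', add_assoc, add_self_eq_zero (k := k), add_zero]
  · rw [h, h', add_right_comm, add_self_eq_zero (k := k), zero_add]
  · rw [h, h', add_self_eq_zero (k := k), zero_add]

/-- The model built from elements satisfying the relations of the generators of the Grigorchuk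
group, in characteristic `2`. -/
noncomputable def modelOfGenerators {R : Type*} [Ring R] [Algebra k R] (g : Gen → R)
    (hgg : ∀ s, g s * g s = 1) (hbc : g .b * g .c = g .d) (hcb : g .c * g .b = g .d)
    (hsum : g .b + g .c + g .d = 1) (hadj : ∀ x, x ∈ Algebra.adjoin k (Set.range g))
    (Φ : R →ₐ[k] Matrix (Fin 2) (Fin 2) R) (hΦ : Function.Injective Φ)
    (hΦa : Φ (g .a) = !![0, 1; 1, 0]) (hΦb : Φ (g .b) = !![g .a, 0; 0, g .c])
    (hΦc : Φ (g .c) = !![g .a, 0; 0, g .d]) (ε : R →ₐ[k] k) (hε : ∀ s, ε (g s) = 1) :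
    GrigorchukModel k R :=
  have h2 : ∀ x : R, x + x = 0 := add_self_eq_zero (k := k)
  have hsub : ∀ x y : R, x - y = x + y := fun x y => by
    rw [sub_eq_iff_eq_add, add_assoc, h2, add_zero]
  have hd : g .d = g .b + g .c + 1 := by rw [← hsum, ← add_assoc, h2, zero_add]
  have hD : g .b - 1 + (g .c - 1) = g .d - 1 := by
    rw [hd, ← add_sub_right_comm, add_sub_cancel_right, hsub (g .c), ← add_assoc, hsub,
      add_assoc, h2, add_zero]
  have hsq : ∀ s, (g s - 1) * (g s - 1) = 0 := fun s => by
    rw [hsub, mul_add, add_mul, hgg, mul_one, one_mul, add_comm (g s), h2]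
  { A := g .a - 1
    B := g .b - 1
    C := g .c - 1
    Φ := Φ
    ε := ε
    Φ_injective := hΦ
    Φ_A := by
      rw [hsub, map_add, map_one, hΦa]
      ext1 i j
      fin_cases i <;> fin_cases j <;> simp
    Φ_B := by
      rw [map_sub, map_one, hΦb]
      ext1 i j
      fin_cases i <;> fin_cases j <;> simp
    Φ_C := by
      rw [hD, map_sub, map_one, hΦc]
      ext1 i j
      fin_cases i <;> fin_cases j <;> simp
    A_mul_A := hsq _
    B_mul_B := hsq _
    C_mul_C := hsq _
    B_mul_C := by
      -- The product expands to d + b + c + 1, and d = b + c + 1, so it has the form x + x.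
      rw [hsub, hsub, mul_add, add_mul, hbc, mul_one, one_mul, hd, ← h2 (g .b + g .c + 1)]
      abel
    C_mul_B := by
      rw [hsub, hsub, mul_add, add_mul, hcb, mul_one, one_mul, hd, ← h2 (g .b + g .c + 1)]
      abel
    ε_A := by rw [map_sub, hε, map_one, sub_self]
    ε_B := by rw [map_sub, hε, map_one, sub_self]
    ε_C := by rw [map_sub, hε, map_one, sub_self]
    adjoin_eq_top := by
      set W := Algebra.adjoin k {g .a - 1, g .b - 1, g .c - 1}
      have ha : g .a - 1 ∈ W := Algebra.subset_adjoin (by simp)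
      have hb : g .b - 1 ∈ W := Algebra.subset_adjoin (by simp)
      have hc : g .c - 1 ∈ W := Algebra.subset_adjoin (by simp)
      have hd : g .d - 1 ∈ W := by rw [← hD]; exact add_mem hb hc
      rw [← top_le_iff]
      intro T _
      refine Algebra.adjoin_le ?_ (hadj T)
      rintro _ ⟨s, rfl⟩
      rw [SetLike.mem_coe, ← sub_add_cancel (g s) 1]
      refine add_mem ?_ (one_mem _)
      cases s
      exacts [ha, hb, hc, hd] }

variable (k)

/-- The tree enveloping algebra of the Grigorchuk group with its matrix recursion. -/
noncomputable def model : GrigorchukModel k (Alg k) :=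
  modelOfGenerators (gen k) gen_mul_self gen_b_mul_gen_c gen_c_mul_gen_b gen_add_gen_add_gen
    mem_adjoin_range_gen (recursion k) recursion_injective recursion_gen_a recursion_gen_b
    recursion_gen_c (augmentation k group) augmentation_gen

theorem shiftedGen_d : shiftedGen k .d = (model k).B + (model k).C := by
  refine alg_ext fun x => ?_
  change (gen k .d).1 (MonoidAlgebra.single x 1) - MonoidAlgebra.single x 1 =
    ((gen k .b).1 (MonoidAlgebra.single x 1) - MonoidAlgebra.single x 1) +
      ((gen k .c).1 (MonoidAlgebra.single x 1) - MonoidAlgebra.single x 1)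
  have h2 := add_self_eq_zero (k := k) (V := MonoidAlgebra k Ray)
  simp only [gen_single]
  rcases act_eq x with ⟨h, h'⟩ | ⟨h, h'⟩ | ⟨h, h'⟩
  · rw [h, h', sub_self, zero_add]
  · rw [h, h', sub_self, add_zero]
  · rw [h, h', sub_self, h2]

theorem homogeneous_eq : homogeneous k = fun n => (model k).gens ^ n := by
  have h : Submodule.span k (Set.range (shiftedGen k)) = (model k).gens := by
    apply le_antisymm
    · rw [Submodule.span_le]
      rintro _ ⟨s, rfl⟩
      have hb : (model k).B ∈ (model k).gens := (model k).letters_le 1 (model k).B_mem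
      have hc : (model k).C ∈ (model k).gens := (model k).letters_le 1 (model k).C_mem
      cases s with
      | a => exact (model k).letters_le 0 (model k).A_mem
      | b => exact hb
      | c => exact hc
      | d => rw [shiftedGen_d]; exact add_mem hb hc
    · refine Submodule.span_mono ?_
      rintro _ (rfl | rfl | rfl)
      exacts [⟨.a, rfl⟩, ⟨.b, rfl⟩, ⟨.c, rfl⟩]
  funext n
  rw [homogeneous, productSpan, h]

end CharTwo

end Grigorchuk

/-! ### Transfer from the model to the tree enveloping algebra -/

theorem mainTheorem5 (k : Type*) [Field k] [CharP k 2] :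
    -- the successive quotients of the powers of the augmentation ideal
    (∀ n j : ℕ, 3 ≤ n →
      (2 ^ j ≤ n → (n : ℝ) ≤ 3 / 2 * 2 ^ j →
        (powerQuotientDim k (Grigorchuk.Alg k) (Grigorchuk.augIdeal k) n : ℝ) = 2 * n - 2 ^ j / 2) ∧
      (3 / 2 * 2 ^ j ≤ (n : ℝ) → n ≤ 2 ^ (j + 1) →
        powerQuotientDim k (Grigorchuk.Alg k) (Grigorchuk.augIdeal k) n = n + 2 ^ j)) ∧
    -- the algebra is graded along the powers of its augmentation ideal
    (Nonempty (GradedAlgebra (Grigorchuk.homogeneous k)) ∧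
      ∀ n : ℕ, (Grigorchuk.augIdeal k ^ n).restrictScalars k =
        ⨆ m ≥ n, Grigorchuk.homogeneous k m) ∧
    -- quadratic growth and dimension two as a graded algebra
    (HasPolynomialGrowth 2
        (fun n => Module.finrank k (partialSum k (Grigorchuk.homogeneous k) n)) ∧
      gkDim (fun n => Module.finrank k (partialSum k (Grigorchuk.homogeneous k) n)) = 2) ∧
    -- quadratic growth and dimension two as a finitely generated filtered algebra
    (Algebra.FiniteType k (Grigorchuk.Alg k) ∧
      ∀ S : Set (Grigorchuk.Alg k), S.Finite → Algebra.adjoin k S = ⊤ →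
        HasPolynomialGrowth 2
          (fun n => Module.finrank k (partialSum k (productSpan k S) n)) ∧
        gkDim (fun n => Module.finrank k (partialSum k (productSpan k S) n)) = 2) := by
  set S := Grigorchuk.model k
  rw [Grigorchuk.homogeneous_eq]
  have hdim : ∀ n, powerQuotientDim k (Grigorchuk.Alg k) (Grigorchuk.augIdeal k) n = S.dim n :=
    S.powerQuotientDim_eq
  refine ⟨fun n j hn => ?_, ⟨S.nonempty_gradedAlgebra, S.ker_ε_pow_restrictScalars⟩,
    S.filtrationDim_growth, ⟨⟨?_⟩, fun s hs htop => S.growth_of_finite hs htop⟩⟩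
  · rw [hdim]
    obtain ⟨h₁, h₂⟩ := S.dim_formula n j hn
    refine ⟨fun h h' => ?_, fun h h' => h₂ ?_ h'⟩
    · have h3 : 2 * n ≤ 3 * 2 ^ j := by
        have : (2 : ℝ) * n ≤ 3 * 2 ^ j := by linarith
        exact_mod_cast this
      have h4 : (2 : ℝ) * S.dim n + 2 ^ j = 4 * n := by exact_mod_cast h₁ h h3
      linarith
    · have : (3 : ℝ) * 2 ^ j ≤ 2 * n := by linarith
      exact_mod_cast this
  · exact Subalgebra.fg_def.2 ⟨{S.A, S.B, S.C}, by simp, S.adjoin_eq_top⟩
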